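/- **Setting.** Let $F$ be a $p$-adic field with ring of integers $\mathcal O_F$, uniformizer $\pi_F$, residue field of cardinality $q$, absolute value normalised by $|\pi_F|=q^{-1}$, and valuation $v=-\log_q|\cdot|$, extended to an algebraic closure $\bar F$. Let $n,\alpha,s$ be integers with $\alpha\ge 1$ and $1\le s\le n$. For a partition (ordered) $(m_1,\dots,m_l)$ of an integer $m\geq 1$ into positive integers let $P=MN\subset GL_m$ be the corresponding standard (block upper triangular) parabolic subgroup, with $M=GL_{m_1}\times\cdots\times GL_{m_l}$. For a locally constant compactly supported function $f$ on $GL_m(F)$ its constant term is the function on $M(F)$ $$f^{(P)}(x)=\delta_P(x)^{1/2}\int_{N(F)}f(xu)\,du,\qquad \delta_P(x)=|\det(\mathrm{Ad}(x)\mid \mathrm{Lie}\,N)|,$$ where $N(\mathcal O_F)$ has measure $1$. The Satake transform of a $GL_m(\mathcal O_F)$-bi-invariant $f$ is its constant term along the upper triangular Borel subgroup, viewed as an element of $\mathbb C[X_1^{\pm1},\dots,X_m^{\pm1}]$, where $X^\mu$ corresponds to the characteristic function of $\mathrm{diag}(\pi_F^{\mu_1},\dots,\pi_F^{\mu_m})\,T(\mathcal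 O_F)$ on the diagonal torus $T(F)$. For integers $m\ge 1$ and $r\ge0$ let $f_{m\alpha r}$ be the compactly supported $GL_m(\mathcal O_F)$-bi-invariant function on $GL_m(F)$ with Satake transform $$q^{\alpha r(m-r)/2}\sum_{I\subset\{1,\dots,m\},\ |I|=r}\ \prod_{i\in I}X_i^{\alpha}.$$ For $P=MN\subset GL_n$ corresponding to a partition $(m_1,\dots,m_l)$ of $n$, define functions on $M(F)$: * $C_c^{M}$ is the characteristic function of the set of $(g_1,\dots,g_l)\in M(F)$ such that, for each $i$, all eigenvalues of $g_i$ in $\bar F$ have the same absolute value; * $\chi^{GL_n}_M$ is the characteristic function of the set of $(g_1,\dots,g_l)\in M(F)$ with $\frac{v(\det g_1)}{m_1}>\frac{v(\det g_2)}{m_2}>\cdots>\frac{v(\det g_l)}{m_l}$. For $g\in GL_n(F)$ let $\Phi(g)\in\mathbb R^n$ be the tuple of the valuations of the eigenvalues of $g$ (with multiplicity) in decreasing order. For $b\in\mathbb R^n$ with $b_1\ge\cdots\ge b_n$ let $C_b$ be the characteristic function of $\{g\in GL_n(F):\Phi(g)=tb\text{ for some real }t>0\}$, which we also restrict to $M(F)\subset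 GL_n(F)$. Fix a partition $(n_1,\dots,n_k)$ of $n$ and real numbers $\lambda_1>\cdots>\lambda_k$ such that $s_i:=\lambda_in_i$ is a non-negative integer for every $i$ and $\sum_i s_i=s$. Put $\lambda=(\lambda_1^{n_1},\dots,\lambda_k^{n_k})\in\mathbb R^n$ (each $\lambda_i$ repeated $n_i$ times), let $P_\lambda=M_\lambda N_\lambda$ be the standard parabolic subgroup corresponding to $(n_1,\dots,n_k)$, and put $$C(n_i,s_i)=\frac{s(n-s)}2-\sum_{i=1}^k\frac{s_i(n_i-s_i)}2 .$$ **Proposition 3.3.** 1. If $P=MN\subset GL_n$ is a standard parabolic subgroup with $P\ne P_\lambda$, then the function $C_c^{M}\,C_\lambda\,\chi^{GL_n}_{M}\,f_{n\alpha s}^{(P)}$ on $M(F)$ is $0$. 2. The function $C_c^{M_\lambda}\,C_\lambda\,\chi^{GL_n}_{M_\lambda}\,f_{n\alpha s}^{(P_\lambda)}$ on $M_\lambda(F)$ is locally constant with compact support, and it equals $$q^{\alpha C(n_i,s_i)}\;C_c^{M_\lambda}\,(f_{n_1\alpha s_1}\otimes\cdots\otimes f_{n_k\alpha s_k}).$$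 -/

import Mathlib

open scoped MatrixGroups
open MeasureTheory

noncomputable section

namespace GLTrunc

/-! ### The field, its normalised absolute value and valuation -/

section Field

variable (F : Type*) [NontriviallyNormedField F] [IsUltrametricDist F]

/-- The ring of integers of `F`, i.e. the elements of norm at most `1`. -/
def integers : ValuationSubring F := (NormedField.valuation (K := F)).valuationSubring

/-- The number `q` of elements of the residue field. -/
def resCard : ℕ := Nat.card (IsLocalRing.ResidueField (integers F))

variable {F}

/-- `ϖ` is a uniformizer (an element of largest norm among those of norm `< 1`), and the norm of
`F` is the normalised absolute value, `‖ϖ‖ = q⁻¹`. -/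
structure IsNormalizedUniformizer (ϖ : F) : Prop where
  norm_eq : ‖ϖ‖ = (resCard F : ℝ)⁻¹
  norm_le : ∀ x : F, ‖x‖ < 1 → ‖x‖ ≤ ‖ϖ‖

/-- The valuation `x ↦ -log_q |x|` of a nonzero element of `F`; it is `1` at a uniformizer when the
norm is normalised. -/
def val (x : F) : ℝ := -Real.logb (resCard F) ‖x‖

/-- The extension of `val` to an algebraic closure of `F`, through the unique extension of the
absolute value of `F`. -/
def valBar (x : AlgebraicClosure F) : ℝ :=
  -Real.logb (resCard F) (spectralNorm F (AlgebraicClosure F) x)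

end Field

/-- The compact set with nonempty interior `{x | ‖x‖ ≤ 1}`, the ring of integers. -/
def unitBall (F : Type*) [NontriviallyNormedField F] [ProperSpace F] :
    TopologicalSpace.PositiveCompacts F where
  carrier := Metric.closedBall 0 1
  isCompact' := isCompact_closedBall 0 1
  interior_nonempty' :=
    ⟨0, Metric.ball_subset_interior_closedBall (Metric.mem_ball_self one_pos)⟩

/-- The additive Haar measure on `F` that gives the ring of integers measure `1`. -/
def haarF (F : Type*) [NontriviallyNormedField F] [ProperSpace F] [MeasurableSpace F]
    [BorelSpace F] : Measure F :=
  Measure.addHaarMeasure (unitBall F)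

/-! ### Hecke algebras -/

/-- Membership in the Hecke algebra: locally constant with compact support. -/
structure IsHecke {G : Type*} [TopologicalSpace G] (f : G → ℂ) : Prop where
  locConst : IsLocallyConstant f
  compactSupport : HasCompactSupport f

/-- The hyperspecial maximal compact subgroup `GL_n(𝒪_F)` of `GL_n(F)`. -/
def maxCompact (F : Type*) [NontriviallyNormedField F] [IsUltrametricDist F] (n : ℕ) :
    Subgroup (GL (Fin n) F) :=
  (Matrix.GeneralLinearGroup.map (n := Fin n) (algebraMap (integers F) F)).range

/-- Membership in the unramified Hecke algebra of `GL_n(F)`. -/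
structure IsUnramified {F : Type*} [NontriviallyNormedField F] [IsUltrametricDist F] {n : ℕ}
    (f : GL (Fin n) F → ℂ) : Prop extends IsHecke f where
  biInvariant : ∀ k₁ ∈ maxCompact F n, ∀ k₂ ∈ maxCompact F n, ∀ g, f (k₁ * g * k₂) = f g

/-! ### Standard parabolic subgroups

The standard (block upper triangular) parabolic subgroups `P = M N` of `GL_n` correspond to the
partitions `(n_1, …, n_k)` of `n`, i.e. to the compositions `c` of `n`. -/

section Parabolic

variable {F : Type*} [NontriviallyNormedField F] {n : ℕ}

/-- The Levi subgroup `M(F) = GL_{n_1}(F) × ⋯ × GL_{n_k}(F)`. -/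
abbrev Levi (F : Type*) [NontriviallyNormedField F] {n : ℕ} (c : Composition n) : Type _ :=
  ∀ i : Fin c.length, GL (Fin (c.blocksFun i)) F

/-- The block diagonal embedding `M(F) → GL_n(F)`. -/
def leviEmb (c : Composition n) : Levi F c →* GL (Fin n) F :=
  (Units.map
    ((Matrix.reindexAlgEquiv F F c.blocksFinEquiv).toRingEquiv.toRingHom.comp
      (Matrix.blockDiagonal'RingHom (fun i => Fin (c.blocksFun i)) F)).toMonoidHom).comp
    MulEquiv.piUnits.symm.toMonoidHom

/-- The matrix positions strictly above the diagonal blocks. -/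
abbrev UpperPos (c : Composition n) : Type :=
  {x : Fin n × Fin n // c.index x.1 < c.index x.2}

/-- The matrix `1 + X`, where `X` has the entries `x` above the diagonal blocks. -/
def unipMatrix (c : Composition n) (x : UpperPos c → F) : Matrix (Fin n) (Fin n) F :=
  1 + Matrix.of fun a b => if h : c.index a < c.index b then x ⟨(a, b), h⟩ else 0

theorem det_unipMatrix (c : Composition n) (x : UpperPos c → F) : (unipMatrix c x).det = 1 := by
  have hidx : ∀ a b : Fin n, c.index a < c.index b → a < b := by
    intro a b h
    have h1 : c.sizeUpTo (c.index a + 1) ≤ c.sizeUpTo (c.index b) :=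
      c.monotone_sizeUpTo h
    have h2 := c.lt_sizeUpTo_index_succ a
    have h3 := c.sizeUpTo_index_le b
    exact Fin.lt_def.2 (lt_of_lt_of_le h2 (h1.trans h3))
  rw [Matrix.det_of_isUpperTriangular]
  · simp [unipMatrix]
  · intro a b h
    have hne : a ≠ b := fun e => by simp [e] at h
    have hn : ¬ c.index a < c.index b := fun h' => lt_asymm (hidx a b h') h
    simp [unipMatrix, Matrix.one_apply_ne hne, hn]

/-- The parametrisation of the unipotent radical `N(F)` by its matrix entries. -/
def unip (c : Composition n) (x : UpperPos c → F) : GL (Fin n) F :=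
  Matrix.GeneralLinearGroup.mkOfDetNeZero (unipMatrix c x)
    (by rw [det_unipMatrix]; exact one_ne_zero)

/-- The matrix of `X ↦ m X m⁻¹` on the Lie algebra of `N`, in the basis of elementary matrices. -/
def adMatrix (c : Composition n) (m : Levi F c) : Matrix (UpperPos c) (UpperPos c) F :=
  Matrix.of fun x y => (leviEmb c m).val x.1.1 y.1.1 * (leviEmb c m)⁻¹.val y.1.2 x.1.2

/-- The modular character `δ_P(m) = |det(m, Lie N)|` (for a normalised norm). -/
def modular (c : Composition n) (m : Levi F c) : ℝ := ‖(adMatrix c m).det‖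

/-- The constant term `f^{(P)}(m) = δ_P(m)^{1/2} ∫_{N(F)} f(m n) dn`, where the Haar measure of
`N(F)`, i.e. the product measure in the matrix entries, gives `N(𝒪_F)` measure `1`. -/
def constantTerm [ProperSpace F] [MeasurableSpace F] [BorelSpace F] (c : Composition n)
    (f : GL (Fin n) F → ℂ) (m : Levi F c) : ℂ :=
  (Real.sqrt (modular c m) : ℂ) *
    ∫ x : UpperPos c → F, f (leviEmb c m * unip c x) ∂(Measure.pi fun _ => haarF F)

/-- The diagonal torus inside the Levi subgroup `M(F)`. For the composition `(1, …, 1)` this is an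
isomorphism onto the Levi subgroup of the Borel subgroup. -/
def torusToLevi (c : Composition n) (t : Fin n → Fˣ) : Levi F c := fun i =>
  Units.map (Matrix.diagonalRingHom (Fin (c.blocksFun i)) F).toMonoidHom
    (MulEquiv.piUnits.symm fun j => t (c.embedding i j))

/-- The Satake transform: the constant term along the upper triangular Borel subgroup, as a
function on the diagonal torus. -/
def satake [ProperSpace F] [MeasurableSpace F] [BorelSpace F] (f : GL (Fin n) F → ℂ)
    (t : Fin n → Fˣ) : ℂ :=
  constantTerm (Composition.ones n) f (torusToLevi (Composition.ones n) t)

end Parabolic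

/-! ### Kottwitz functions -/

section KottwitzFunction

/-- The Laurent polynomial ring `ℂ[X_1^{±1}, …, X_n^{±1}]`. -/
abbrev Laurent (n : ℕ) : Type := AddMonoidAlgebra ℂ (Fin n → ℤ)

/-- The variable `X_k`. -/
def X {n : ℕ} (k : Fin n) : Laurent n := AddMonoidAlgebra.single (Pi.single k 1) 1

variable {F : Type*} [NontriviallyNormedField F]

open Classical in
/-- The isomorphism from the Laurent polynomials to the unramified Hecke algebra of the diagonal
torus `T(F)`: the monomial `X^μ` goes to the characteristic function of `ϖ^μ T(𝒪_F)`. -/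
def Laurent.toFun {n : ℕ} (ϖ : F) (p : Laurent n) (t : Fin n → Fˣ) : ℂ :=
  p.coeff.sum fun μ a => if ∀ k, ‖(t k : F)‖ = ‖ϖ‖ ^ μ k then a else 0

variable [IsUltrametricDist F]

/-- The symmetric Laurent polynomial `q^{α s (n - s) / 2} ∑_{|I| = s} (X^I)^α`. -/
def kottwitzPoly (F : Type*) [NontriviallyNormedField F] [IsUltrametricDist F] (n α s : ℕ) :
    Laurent n :=
  (((resCard F : ℝ) ^ ((α : ℝ) * s * ((n : ℝ) - s) / 2) : ℝ) : ℂ) •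
    ∑ I ∈ (Finset.univ : Finset (Fin n)).powersetCard s, (∏ i ∈ I, X i) ^ α

/-- `f` is the function `f_{nαs}`: the element of the unramified Hecke algebra of `GL_n(F)` whose
Satake transform is `q^{α s (n - s) / 2} ∑_{|I| = s} (X^I)^α`. -/
structure IsKottwitzFunction [ProperSpace F] [MeasurableSpace F] [BorelSpace F] (ϖ : F)
    (n α s : ℕ) (f : GL (Fin n) F → ℂ) : Prop where
  unramified : IsUnramified f
  satake_eq : satake f = (kottwitzPoly F n α s).toFun ϖ

end KottwitzFunction

/-! ### Truncations -/

section Truncation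

variable {F : Type*} [NontriviallyNormedField F]

/-- The eigenvalues, with multiplicity, in an algebraic closure of `F`. -/
def eigenvalues {n : ℕ} (g : GL (Fin n) F) : Multiset (AlgebraicClosure F) :=
  g.val.charpoly.aroots (AlgebraicClosure F)

/-- The set `Ω_{M,c}` of compact elements of `M(F)`: in each block, all eigenvalues have the same
absolute value. -/
def compactElements (F : Type*) [NontriviallyNormedField F] {n : ℕ} (c : Composition n) :
    Set (Levi F c) :=
  {m | ∀ i, ∀ x ∈ eigenvalues (m i), ∀ y ∈ eigenvalues (m i),
    spectralNorm F (AlgebraicClosure F) x = spectralNorm F (AlgebraicClosure F) y}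

variable [IsUltrametricDist F] {n : ℕ}

/-- The tuple `Φ(g)` of the valuations of the eigenvalues of `g`, in decreasing order. -/
def slopes (g : GL (Fin n) F) : List ℝ :=
  ((eigenvalues g).map valBar).sort (· ≥ ·)

/-- The set `Ω_b` of the `g` with `Φ(g) = t b` for some real `t > 0`. -/
def slopeSet (F : Type*) [NontriviallyNormedField F] [IsUltrametricDist F] {n : ℕ}
    (b : Fin n → ℝ) : Set (GL (Fin n) F) :=
  {g | ∃ t : ℝ, 0 < t ∧ slopes g = List.ofFn fun a => t * b a}

/-- The set of `m = (m_1, …, m_k)` in `M(F)` on which all roots occurring in the Lie algebra of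
`N` are positive, i.e. `v(det m_1) / n_1 > ⋯ > v(det m_k) / n_k`. -/
def positiveChamber (F : Type*) [NontriviallyNormedField F] [IsUltrametricDist F] {n : ℕ}
    (c : Composition n) : Set (Levi F c) :=
  {m | ∀ i j, i < j →
    val (m j).val.det / c.blocksFun j < val (m i).val.det / c.blocksFun i}

/-- `C_c^{M(F)}`, the characteristic function of the compact elements. -/
def charCompact (c : Composition n) : Levi F c → ℂ := (compactElements F c).indicator 1

/-- `C_b`, the characteristic function of `Ω_b`. -/
def charSlope (b : Fin n → ℝ) : GL (Fin n) F → ℂ := (slopeSet F b).indicator 1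

/-- `χ^{GL_n}_M`, the characteristic function of the positive chamber. -/
def charPositive (c : Composition n) : Levi F c → ℂ := (positiveChamber F c).indicator 1

/-- The function `C_c^{M(F)} C_b χ^{GL_n}_M f^{(P)}` on `M(F)`, where `P = M N` is the standard
parabolic subgroup given by `c`. -/
def truncation [ProperSpace F] [MeasurableSpace F] [BorelSpace F] (c : Composition n)
    (b : Fin n → ℝ) (f : GL (Fin n) F → ℂ) (m : Levi F c) : ℂ :=
  charCompact c m * charSlope b (leviEmb c m) * charPositive c m * constantTerm c f m

/-- The vector `(λ_1^{n_1}, …, λ_k^{n_k})`, in which `λ_i` is repeated `n_i` times. -/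
def repeatVec (c : Composition n) (lam : Fin c.length → ℝ) : Fin n → ℝ := fun a => lam (c.index a)

/-- The constant `C(n_i, s_i) = s (n - s) / 2 - ∑ s_i (n_i - s_i) / 2`. -/
def constC (c : Composition n) (s : ℕ) (si : Fin c.length → ℕ) : ℝ :=
  (s : ℝ) * ((n : ℝ) - s) / 2 - ∑ i, (si i : ℝ) * ((c.blocksFun i : ℝ) - si i) / 2

end Truncation

end GLTrunc

end

/-!
The Satake transform on a Levi subgroup `M` is injective on the unramified functions: if `φ ≠ 0`,
choose in its compact support a torus element `t` whose tuple of norms is maximal for the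
lexicographic order within each block. Comparison with the Cartan form of `t u` shows that the
unipotent elements `u` outside `M(𝒪_F)` do not contribute to the Satake transform of `φ` at `t`,
which therefore does not vanish.

Constant terms are transitive, so the Satake transform of `f^{(P)}` is that of `f`, namely
`q^{α s (n - s) / 2} ∑_{|I| = s} X^{α I}`. Cutting `f^{(P)}` down to the elements whose blocks have
determinants of valuations `α s_i` selects the `I` that meet the `i`-th block in `s_i` elements,
and the sum over these is the product of the polynomials of the `f_{n_i α s_i}`, up to the constant
`q^{α C(n_i, s_i)}`. By injectivity the cut-down function is the corresponding multiple of
`⊗ f_{n_i α s_i}`.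

On a compact element of the positive chamber of a standard parabolic subgroup `P`, the tuple `Φ` is
the decreasing sequence of the block slopes `v(det m_i) / n_i`. Hence `Φ = t λ` forces `P = P_λ`,
and `v(det m) = α s` on the support of `f^{(P)}` then forces the slopes to be `α λ_i`, so that the
truncation is exactly the cut-down to the determinant valuations `α s_i`.
-/

namespace GLTrunc

/-! ### Integral matrices -/

section IntegralMatrices

variable {F : Type*} [NontriviallyNormedField F] [IsUltrametricDist F]

theorem mem_integers_iff {x : F} : x ∈ integers F ↔ ‖x‖ ≤ 1 := by
  rw [integers, Valuation.mem_valuationSubring_iff, NormedField.valuation_apply]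
  exact_mod_cast Iff.rfl

omit [IsUltrametricDist F] in
theorem norm_eq_one_of_mul_eq_one {x y : F} (hx : ‖x‖ ≤ 1) (hy : ‖y‖ ≤ 1) (h : x * y = 1) :
    ‖x‖ = 1 := by
  have hxy : ‖x‖ * ‖y‖ = 1 := by rw [← norm_mul, h, norm_one]
  nlinarith [norm_nonneg x]

theorem isUnit_integers_of_norm_eq_one {x : integers F} (h : ‖(x : F)‖ = 1) : IsUnit x := by
  have hx : (x : F) ≠ 0 := norm_ne_zero_iff.1 (h.trans_ne one_ne_zero)
  refine IsUnit.of_mul_eq_one ⟨(x : F)⁻¹, mem_integers_iff.2 (by simp [h])⟩ ?_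
  ext
  simp [hx]

theorem norm_mul_apply_le {l m n : Type*} [Fintype m] {A : Matrix l m F} {B : Matrix m n F}
    {C D : ℝ} (hC : 0 ≤ C) (hD : 0 ≤ D) (hA : ∀ a b, ‖A a b‖ ≤ C) (hB : ∀ a b, ‖B a b‖ ≤ D)
    (a : l) (b : n) : ‖(A * B) a b‖ ≤ C * D := by
  rw [Matrix.mul_apply]
  refine IsUltrametricDist.norm_sum_le_of_forall_le_of_nonneg (by positivity) fun i _ => ?_
  rw [norm_mul]
  exact mul_le_mul (hA _ _) (hB _ _) (norm_nonneg _) hC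

omit [IsUltrametricDist F] in
theorem norm_one_apply_le {m : Type*} [DecidableEq m] (a b : m) :
    ‖(1 : Matrix m m F) a b‖ ≤ 1 := by
  rw [Matrix.one_apply]
  split_ifs <;> simp

/-- The matrix over the ring of integers underlying a matrix with integral entries. -/
def integralMatrix {m : Type*} (A : Matrix m m F) (hA : ∀ a b, ‖A a b‖ ≤ 1) :
    Matrix m m (integers F) :=
  Matrix.of fun a b => ⟨A a b, mem_integers_iff.2 (hA a b)⟩

theorem coe_det_integralMatrix {m : Type*} [Fintype m] [DecidableEq m] (A : Matrix m m F)
    (hA : ∀ a b, ‖A a b‖ ≤ 1) : ((integralMatrix A hA).det : F) = A.det :=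
  RingHom.map_det (algebraMap (integers F) F) (integralMatrix A hA)

theorem norm_det_le_one {m : Type*} [Fintype m] [DecidableEq m] {A : Matrix m m F}
    (hA : ∀ a b, ‖A a b‖ ≤ 1) : ‖A.det‖ ≤ 1 := by
  rw [← coe_det_integralMatrix A hA]
  exact mem_integers_iff.1 (integralMatrix A hA).det.2

variable {n : ℕ} {k : GL (Fin n) F}

theorem norm_apply_le_one_of_mem_maxCompact (hk : k ∈ maxCompact F n) (a b : Fin n) :
    ‖k.val a b‖ ≤ 1 := by
  obtain ⟨k, rfl⟩ := hk
  exact mem_integers_iff.1 (k.val a b).2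

theorem norm_det_eq_one_of_integral (h : ∀ a b, ‖k.val a b‖ ≤ 1)
    (h' : ∀ a b, ‖(k⁻¹).val a b‖ ≤ 1) : ‖k.val.det‖ = 1 :=
  norm_eq_one_of_mul_eq_one (norm_det_le_one h) (norm_det_le_one h')
    (by rw [← Matrix.det_mul, Units.mul_inv, Matrix.det_one])

theorem mem_maxCompact_iff :
    k ∈ maxCompact F n ↔ (∀ a b, ‖k.val a b‖ ≤ 1) ∧ ‖k.val.det‖ = 1 := by
  constructor
  · exact fun hk => ⟨norm_apply_le_one_of_mem_maxCompact hk, norm_det_eq_one_of_integral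
      (norm_apply_le_one_of_mem_maxCompact hk) (norm_apply_le_one_of_mem_maxCompact (inv_mem hk))⟩
  · rintro ⟨h, hdet⟩
    have hunit : IsUnit (integralMatrix k.val h).det :=
      isUnit_integers_of_norm_eq_one (by rw [coe_det_integralMatrix, hdet])
    exact ⟨Matrix.GeneralLinearGroup.mk'' (integralMatrix k.val h) hunit, Units.ext rfl⟩

theorem mem_maxCompact_of_integral (h : ∀ a b, ‖k.val a b‖ ≤ 1)
    (h' : ∀ a b, ‖(k⁻¹).val a b‖ ≤ 1) : k ∈ maxCompact F n :=
  mem_maxCompact_iff.2 ⟨h, norm_det_eq_one_of_integral h h'⟩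

theorem exists_mem_maxCompact {A : Matrix (Fin n) (Fin n) F} (hA : ∀ a b, ‖A a b‖ ≤ 1)
    (hdet : ‖A.det‖ = 1) : ∃ k ∈ maxCompact F n, k.val = A :=
  ⟨Matrix.GeneralLinearGroup.mkOfDetNeZero A (norm_ne_zero_iff.1 (hdet.trans_ne one_ne_zero)),
    mem_maxCompact_iff.2 ⟨hA, hdet⟩, rfl⟩

theorem exists_permMatrix_mem_maxCompact (σ : Equiv.Perm (Fin n)) :
    ∃ k ∈ maxCompact F n, k.val = σ.permMatrix F := by
  refine exists_mem_maxCompact (fun i j => ?_) ?_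
  · rw [Equiv.Perm.permMatrix, PEquiv.toMatrix_apply]
    split_ifs <;> simp
  · rw [Matrix.det_permutation]
    rcases Int.units_eq_one_or (Equiv.Perm.sign σ) with h | h <;> simp [h]

end IntegralMatrices

namespace IsNormalizedUniformizer

variable {F : Type*} [NontriviallyNormedField F] [IsUltrametricDist F] {ϖ : F}

theorem norm_pos (hϖ : IsNormalizedUniformizer ϖ) : 0 < ‖ϖ‖ := by
  obtain ⟨x, hx0, hx⟩ := NormedField.exists_norm_lt_one F
  exact hx0.trans_le (hϖ.norm_le x hx)

theorem one_lt_resCard (hϖ : IsNormalizedUniformizer ϖ) : 1 < resCard F := by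
  have hne : resCard F ≠ 0 := fun h => by simpa [hϖ.norm_eq, h] using hϖ.norm_pos
  have := Nat.finite_of_card_ne_zero hne
  exact Finite.one_lt_card

theorem norm_lt_one (hϖ : IsNormalizedUniformizer ϖ) : ‖ϖ‖ < 1 := by
  rw [hϖ.norm_eq]
  exact inv_lt_one_of_one_lt₀ (by exact_mod_cast hϖ.one_lt_resCard)

theorem norm_eq_one_of_lt (hϖ : IsNormalizedUniformizer ϖ) {x : F} (h : ‖ϖ‖ < ‖x‖)
    (h' : ‖x‖ ≤ 1) : ‖x‖ = 1 :=
  h'.eq_or_lt.resolve_right fun hlt => (hϖ.norm_le x hlt).not_gt h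

theorem exists_norm_eq_zpow (hϖ : IsNormalizedUniformizer ϖ) {x : F} (hx : x ≠ 0) :
    ∃ k : ℤ, ‖x‖ = ‖ϖ‖ ^ k := by
  have hpos := hϖ.norm_pos
  obtain ⟨k, hlt, hle⟩ := exists_mem_Ioc_zpow (norm_pos_iff.2 hx)
    ((one_lt_inv₀ hpos).2 hϖ.norm_lt_one)
  rw [inv_zpow] at hlt hle
  have hp : 0 < ‖ϖ‖ ^ (k + 1) := zpow_pos hpos _
  have hnorm : ‖x * ϖ ^ (k + 1)‖ = ‖x‖ * ‖ϖ‖ ^ (k + 1) := by rw [norm_mul, norm_zpow]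
  have hone : ‖x * ϖ ^ (k + 1)‖ = 1 := by
    refine hϖ.norm_eq_one_of_lt ?_ ?_ <;> rw [hnorm]
    · calc ‖ϖ‖ = (‖ϖ‖ ^ k)⁻¹ * ‖ϖ‖ ^ (k + 1) := by
            rw [zpow_add_one₀ hpos.ne', inv_mul_cancel_left₀ (zpow_pos hpos k).ne']
        _ < ‖x‖ * ‖ϖ‖ ^ (k + 1) := by gcongr
    · rwa [← le_inv_mul_iff₀' hp, mul_one]
  exact ⟨-(k + 1), by rw [zpow_neg, ← mul_eq_one_iff_eq_inv₀ hp.ne', ← hnorm, hone]⟩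

end IsNormalizedUniformizer

/-! ### The Cartan decomposition -/

section ConsMatrix

variable {F : Type*} {m : ℕ}

/-- The matrix with blocks `a`, `r`, `c` and `A`. -/
def consMatrix (a : F) (r c : Fin m → F) (A : Matrix (Fin m) (Fin m) F) :
    Matrix (Fin (m + 1)) (Fin (m + 1)) F :=
  Matrix.of (Fin.cons (Fin.cons a r) fun i => Fin.cons (c i) (A i))

variable (a : F) (r c : Fin m → F) (A : Matrix (Fin m) (Fin m) F)

@[simp] theorem consMatrix_zero_zero : consMatrix a r c A 0 0 = a := rfl
@[simp] theorem consMatrix_zero_succ (j : Fin m) : consMatrix a r c A 0 j.succ = r j := rfl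
@[simp] theorem consMatrix_succ_zero (i : Fin m) : consMatrix a r c A i.succ 0 = c i := rfl
@[simp] theorem consMatrix_succ_succ (i j : Fin m) : consMatrix a r c A i.succ j.succ = A i j := rfl
@[simp] theorem consMatrix_submatrix_succ :
    (consMatrix a r c A).submatrix Fin.succ Fin.succ = A := rfl

theorem eq_consMatrix (A : Matrix (Fin (m + 1)) (Fin (m + 1)) F) :
    A = consMatrix (A 0 0) (fun j => A 0 j.succ) (fun i => A i.succ 0)
      (A.submatrix Fin.succ Fin.succ) := by
  ext i j
  cases i using Fin.cases <;> cases j using Fin.cases <;> rfl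

variable [Field F] (b : F) (B : Matrix (Fin m) (Fin m) F)

theorem det_consMatrix_of_row : (consMatrix a 0 c A).det = a * A.det := by
  simp [Matrix.det_succ_row_zero, Fin.sum_univ_succ]

theorem det_consMatrix_of_col : (consMatrix a r 0 A).det = a * A.det := by
  simp [Matrix.det_succ_column_zero, Fin.sum_univ_succ]

theorem consMatrix_mul_diag :
    consMatrix a 0 0 A * consMatrix b 0 0 B = consMatrix (a * b) 0 0 (A * B) := by
  ext i j
  cases i using Fin.cases <;> cases j using Fin.cases <;>
    simp [Matrix.mul_apply, Fin.sum_univ_succ]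

variable {a} in
theorem consMatrix_factor (ha : a ≠ 0) :
    consMatrix a r c A = consMatrix 1 0 (fun i => c i / a) 1 *
      consMatrix a 0 0 (A - Matrix.of fun i j => c i * r j / a) *
        consMatrix 1 (fun j => r j / a) 0 1 := by
  ext i j
  simp only [Matrix.mul_apply, Fin.sum_univ_succ]
  cases i using Fin.cases <;> cases j using Fin.cases <;> simp [Matrix.one_apply] <;> field_simp
  ring

/-- The block diagonal matrix `(a, g)`. -/
def consGL (a : Fˣ) (g : GL (Fin m) F) : GL (Fin (m + 1)) F :=
  Matrix.GeneralLinearGroup.mkOfDetNeZero (consMatrix a 0 0 g.val) (by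
    rw [det_consMatrix_of_row]
    exact mul_ne_zero a.ne_zero g.det.ne_zero)

theorem consGL_mul (a b : Fˣ) (g h : GL (Fin m) F) :
    consGL a g * consGL b h = consGL (a * b) (g * h) :=
  Units.ext (consMatrix_mul_diag _ _ _ _)

end ConsMatrix

section Diagonal

variable {F : Type*} [NontriviallyNormedField F] {m : ℕ}

/-- The diagonal matrix with entries `t`. -/
def diagGL (t : Fin m → Fˣ) : GL (Fin m) F :=
  Units.map (Matrix.diagonalRingHom (Fin m) F).toMonoidHom (MulEquiv.piUnits.symm t)

@[simp] theorem diagGL_val (t : Fin m → Fˣ) :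
    (diagGL t).val = Matrix.diagonal fun a => (t a : F) := rfl

theorem diagGL_inv (t : Fin m → Fˣ) : (diagGL t)⁻¹ = diagGL t⁻¹ := by
  refine inv_eq_of_mul_eq_one_left ?_
  ext a b
  by_cases h : a = b <;> simp [h]

theorem consGL_diagGL (a : Fˣ) (t : Fin m → Fˣ) :
    consGL a (diagGL t) = diagGL (Fin.cons a t) := by
  ext i j
  change consMatrix _ _ _ _ i j = _
  cases i using Fin.cases <;> cases j using Fin.cases <;> simp [Matrix.diagonal_apply, eq_comm]

end Diagonal

section Cartan

variable {F : Type*} [NontriviallyNormedField F] [IsUltrametricDist F] {m : ℕ}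

omit [IsUltrametricDist F] in
theorem norm_consMatrix_apply_le {C : ℝ} {a : F} {r c : Fin m → F} {A : Matrix (Fin m) (Fin m) F}
    (ha : ‖a‖ ≤ C) (hr : ∀ j, ‖r j‖ ≤ C) (hc : ∀ i, ‖c i‖ ≤ C) (hA : ∀ i j, ‖A i j‖ ≤ C)
    (i j : Fin (m + 1)) : ‖consMatrix a r c A i j‖ ≤ C := by
  cases i using Fin.cases with
  | zero => exact Fin.cases ha hr j
  | succ i => exact Fin.cases (hc i) (hA i) j

theorem consGL_mem_maxCompact {a : Fˣ} (ha : ‖(a : F)‖ = 1) {g : GL (Fin m) F}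
    (hg : g ∈ maxCompact F m) : consGL a g ∈ maxCompact F (m + 1) := by
  rw [mem_maxCompact_iff] at hg ⊢
  refine ⟨norm_consMatrix_apply_le ha.le (by simp) (by simp) hg.1, ?_⟩
  change ‖(consMatrix _ _ _ _).det‖ = 1
  rw [det_consMatrix_of_row, norm_mul, ha, hg.2, one_mul]

theorem exists_mem_maxCompact_row {r : Fin m → F} (hr : ∀ j, ‖r j‖ ≤ 1) :
    ∃ k ∈ maxCompact F (m + 1), k.val = consMatrix 1 r 0 1 :=
  exists_mem_maxCompact (norm_consMatrix_apply_le norm_one.le hr (by simp) norm_one_apply_le)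
    (by simp [det_consMatrix_of_col])

theorem exists_mem_maxCompact_col {c : Fin m → F} (hc : ∀ j, ‖c j‖ ≤ 1) :
    ∃ k ∈ maxCompact F (m + 1), k.val = consMatrix 1 0 c 1 :=
  exists_mem_maxCompact (norm_consMatrix_apply_le norm_one.le (by simp) hc norm_one_apply_le)
    (by simp [det_consMatrix_of_row])

/-- `g` and `g'` lie in the same double coset of the maximal compact subgroup. -/
def MaxCompactRel (g g' : GL (Fin m) F) : Prop :=
  ∃ k₁ ∈ maxCompact F m, ∃ k₂ ∈ maxCompact F m, k₁ * g * k₂ = g'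

namespace MaxCompactRel

variable {g g' g'' : GL (Fin m) F}

theorem symm (h : MaxCompactRel g g') : MaxCompactRel g' g := by
  obtain ⟨k₁, h₁, k₂, h₂, rfl⟩ := h
  exact ⟨k₁⁻¹, inv_mem h₁, k₂⁻¹, inv_mem h₂, by group⟩

theorem trans (h : MaxCompactRel g g') (h' : MaxCompactRel g' g'') : MaxCompactRel g g'' := by
  obtain ⟨k₁, h₁, k₂, h₂, rfl⟩ := h
  obtain ⟨l₁, h₃, l₂, h₄, rfl⟩ := h'
  exact ⟨l₁ * k₁, mul_mem h₃ h₁, k₂ * l₂, mul_mem h₂ h₄, by group⟩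

theorem consGL (a : Fˣ) (h : MaxCompactRel g g') :
    MaxCompactRel (consGL a g) (GLTrunc.consGL a g') := by
  obtain ⟨k₁, h₁, k₂, h₂, rfl⟩ := h
  refine ⟨GLTrunc.consGL 1 k₁, consGL_mem_maxCompact (by simp) h₁, GLTrunc.consGL 1 k₂,
    consGL_mem_maxCompact (by simp) h₂, ?_⟩
  rw [consGL_mul, consGL_mul, one_mul, mul_one]

theorem norm_le (h : MaxCompactRel g g') {C : ℝ} (hC : 0 ≤ C) (hg : ∀ i j, ‖g.val i j‖ ≤ C)
    (i j : Fin m) : ‖g'.val i j‖ ≤ C := by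
  obtain ⟨k₁, h₁, k₂, h₂, rfl⟩ := h
  simpa using norm_mul_apply_le (mul_nonneg zero_le_one hC) zero_le_one
    (norm_mul_apply_le zero_le_one hC (norm_apply_le_one_of_mem_maxCompact h₁) hg)
    (norm_apply_le_one_of_mem_maxCompact h₂) i j

end MaxCompactRel

/-- A Cartan decomposition `g ∈ GL_m(𝒪_F) t GL_m(𝒪_F)`, with the entries of `t` in decreasing
order of absolute value. -/
structure IsCartanForm (g : GL (Fin m) F) (t : Fin m → Fˣ) : Prop where
  rel : MaxCompactRel g (diagGL t)
  antitone : Antitone fun i => ‖(t i : F)‖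

namespace IsCartanForm

variable {g g' : GL (Fin m) F} {t : Fin m → Fˣ}

theorem of_rel (h : MaxCompactRel g g') (ht : IsCartanForm g' t) : IsCartanForm g t :=
  ⟨h.trans ht.rel, ht.antitone⟩

theorem norm_le (ht : IsCartanForm g t) {C : ℝ} (hC : 0 ≤ C) (hg : ∀ i j, ‖g.val i j‖ ≤ C)
    (i : Fin m) : ‖(t i : F)‖ ≤ C := by
  simpa using ht.rel.norm_le hC hg i i

theorem consGL (ht : IsCartanForm g t) {a : Fˣ} (ha : ∀ i j, ‖g.val i j‖ ≤ ‖(a : F)‖) :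
    IsCartanForm (consGL a g) (Fin.cons a t) where
  rel := consGL_diagGL a t ▸ ht.rel.consGL a
  antitone i j hij := by
    cases i using Fin.cases with
    | zero => exact Fin.cases le_rfl (ht.norm_le (norm_nonneg _) ha) j
    | succ i =>
      cases j using Fin.cases with
      | zero => simp at hij
      | succ j => exact ht.antitone (Fin.succ_le_succ_iff.1 hij)

theorem norm_apply_le {g : GL (Fin (m + 1)) F} {t : Fin (m + 1) → Fˣ} (ht : IsCartanForm g t)
    (i j : Fin (m + 1)) : ‖g.val i j‖ ≤ ‖(t 0 : F)‖ := by
  refine ht.rel.symm.norm_le (norm_nonneg _) (fun i j => ?_) i j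
  rw [diagGL_val, Matrix.diagonal_apply]
  split_ifs
  · exact ht.antitone (Fin.zero_le i)
  · simp

end IsCartanForm

theorem exists_maxCompactRel_consGL {g : GL (Fin (m + 1)) F}
    (hmax : ∀ i j, ‖g.val i j‖ ≤ ‖g.val 0 0‖) :
    ∃ (a : Fˣ) (g' : GL (Fin m) F), (a : F) = g.val 0 0 ∧
      (∀ i j, g'.val i j = g.val i.succ j.succ - g.val i.succ 0 * g.val 0 j.succ / g.val 0 0) ∧
      MaxCompactRel g (consGL a g') := by
  have ha : g.val 0 0 ≠ 0 := fun h0 =>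
    g.ne_zero (by ext i j; simpa [h0] using hmax i j)
  have hratio : ∀ x, ‖x‖ ≤ ‖g.val 0 0‖ → ‖x / g.val 0 0‖ ≤ 1 := fun x hx => by
    rw [norm_div]
    exact div_le_one_of_le₀ hx (norm_nonneg _)
  obtain ⟨k₁, hk₁, hv₁⟩ := exists_mem_maxCompact_col fun i => hratio _ (hmax (Fin.succ i) 0)
  obtain ⟨k₂, hk₂, hv₂⟩ := exists_mem_maxCompact_row fun j => hratio _ (hmax 0 (Fin.succ j))
  set A : Matrix (Fin m) (Fin m) F := g.val.submatrix Fin.succ Fin.succ -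
    Matrix.of fun i j => g.val i.succ 0 * g.val 0 j.succ / g.val 0 0
  have hfactor : g.val = k₁.val * consMatrix (g.val 0 0) 0 0 A * k₂.val := by
    conv_lhs => rw [eq_consMatrix g.val, consMatrix_factor _ _ _ ha]
    rw [hv₁, hv₂]
  have hdet : A.det ≠ 0 := fun h0 => g.det.ne_zero <| by
    rw [Matrix.GeneralLinearGroup.val_det_apply, hfactor, Matrix.det_mul, Matrix.det_mul,
      det_consMatrix_of_row, h0, mul_zero, mul_zero, zero_mul]
  exact ⟨Units.mk0 _ ha, Matrix.GeneralLinearGroup.mkOfDetNeZero A hdet, rfl, fun i j => rfl,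
    .symm ⟨k₁, hk₁, k₂, hk₂, Units.ext hfactor.symm⟩⟩

theorem exists_maxCompactRel_norm_apply_le (g : GL (Fin (m + 1)) F) :
    ∃ g', MaxCompactRel g g' ∧ ∀ i j, ‖g'.val i j‖ ≤ ‖g'.val 0 0‖ := by
  obtain ⟨⟨i₀, j₀⟩, -, hmax⟩ := Finset.exists_max_image Finset.univ
    (fun p : Fin (m + 1) × Fin (m + 1) => ‖g.val p.1 p.2‖) ⟨(0, 0), Finset.mem_univ _⟩
  obtain ⟨k₁, hk₁, hv₁⟩ := exists_permMatrix_mem_maxCompact (F := F) (Equiv.swap 0 i₀)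
  obtain ⟨k₂, hk₂, hv₂⟩ := exists_permMatrix_mem_maxCompact (F := F) (Equiv.swap 0 j₀)
  have hval : ∀ i j, (k₁ * g * k₂).val i j =
      g.val (Equiv.swap 0 i₀ i) (Equiv.swap 0 j₀ j) := by
    intro i j
    rw [Units.val_mul, Units.val_mul, hv₁, hv₂, PEquiv.mul_toMatrix_toPEquiv,
      PEquiv.toMatrix_toPEquiv_mul]
    simp
  refine ⟨k₁ * g * k₂, ⟨k₁, hk₁, k₂, hk₂, rfl⟩, fun i j => ?_⟩
  rw [hval, hval, Equiv.swap_apply_left, Equiv.swap_apply_left]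
  exact hmax (_, _) (Finset.mem_univ _)

theorem exists_isCartanForm (g : GL (Fin m) F) : ∃ t, IsCartanForm g t := by
  induction m with
  | zero => exact ⟨fun _ => 1, ⟨1, one_mem _, 1, one_mem _, Subsingleton.elim _ _⟩,
      Subsingleton.antitone _⟩
  | succ m ih =>
    obtain ⟨g₁, hrel₁, hmax⟩ := exists_maxCompactRel_norm_apply_le g
    obtain ⟨a, g', ha, -, hrel₂⟩ := exists_maxCompactRel_consGL hmax
    obtain ⟨t, ht⟩ := ih g'
    refine ⟨Fin.cons a t, .of_rel (hrel₁.trans hrel₂) (ht.consGL fun i j => ?_)⟩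
    rw [ha]
    exact hrel₂.norm_le (norm_nonneg _) hmax i.succ j.succ

theorem toLex_le_of_zero_of_succ {v w : Fin (m + 1) → ℝ} (h0 : v 0 = w 0)
    (h : toLex (fun i : Fin m => v i.succ) ≤ toLex (fun i : Fin m => w i.succ)) :
    toLex v ≤ toLex w := by
  rcases h.eq_or_lt with h | ⟨i, hi, hlt⟩
  · exact (congrArg toLex (funext (Fin.cases h0 (congrFun (toLex.injective h))))).le
  · refine le_of_lt ⟨i.succ, fun j => ?_, hlt⟩
    exact Fin.cases (fun _ => h0) (fun j hj => hi j (Fin.succ_lt_succ_iff.1 hj)) j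

theorem exists_isCartanForm_of_upper (g : GL (Fin m) F) (hg : ∀ i j, j < i → g.val i j = 0) :
    ∃ t, IsCartanForm g t ∧
      toLex (fun i => ‖g.val i i‖) ≤ toLex (fun i => ‖(t i : F)‖) ∧
      ((∀ i, ‖g.val i i‖ = ‖(t i : F)‖) → ∀ i j, ‖g.val i j‖ ≤ ‖g.val i i‖) := by
  induction m with
  | zero =>
    obtain ⟨t, ht⟩ := exists_isCartanForm g
    exact ⟨t, ht, (congrArg toLex (Subsingleton.elim _ _)).le, fun _ i => i.elim0⟩
  | succ m ih =>
    by_cases hmax : ∀ i j, ‖g.val i j‖ ≤ ‖g.val 0 0‖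
    · obtain ⟨a, g', ha, hg', hrel⟩ := exists_maxCompactRel_consGL hmax
      replace hg' : ∀ i j, g'.val i j = g.val i.succ j.succ := fun i j => by
        rw [hg', hg i.succ 0 (Fin.succ_pos i), zero_mul, zero_div, sub_zero]
      obtain ⟨t, ht, hlex, heq⟩ := ih g' fun i j hij => by
        rw [hg', hg _ _ (Fin.succ_lt_succ_iff.2 hij)]
      simp only [hg'] at hlex heq
      refine ⟨Fin.cons a t, .of_rel hrel (ht.consGL fun i j => ?_),
        toLex_le_of_zero_of_succ (by simp [ha]) hlex, fun h i j => ?_⟩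
      · rw [hg', ha]
        exact hmax _ _
      · cases i using Fin.cases with
        | zero => exact hmax 0 j
        | succ i =>
          refine Fin.cases ?_ (heq (fun i => h i.succ) i) j
          rw [hg i.succ 0 (Fin.succ_pos i), norm_zero]
          exact norm_nonneg _
    · obtain ⟨t, ht⟩ := exists_isCartanForm g
      have hlt : ‖g.val 0 0‖ < ‖(t 0 : F)‖ :=
        lt_of_not_ge fun hle => hmax fun i j => (ht.norm_apply_le i j).trans hle
      exact ⟨t, ht, le_of_lt ⟨0, fun j hj => absurd hj (Fin.not_lt_zero j), hlt⟩,
        fun h => absurd (h 0) hlt.ne⟩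

end Cartan

/-! ### Levi subgroups and unipotent radicals -/

section Unipotent

variable {F : Type*} [NontriviallyNormedField F] {n : ℕ}

theorem ones_index_val (a : Fin n) : ((Composition.ones n).index a : ℕ) = a := by
  have hle := (Composition.ones n).sizeUpTo_index_le a
  have hlt := (Composition.ones n).lt_sizeUpTo_index_succ a
  have hlength := ((Composition.ones n).index a).2
  rw [Composition.ones_sizeUpTo] at hle hlt
  simp only [Composition.ones_length, Fin.val_succ] at hle hlt hlength
  omega

theorem ones_index_lt_iff {a b : Fin n} :
    (Composition.ones n).index a < (Composition.ones n).index b ↔ a < b := by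
  rw [Fin.lt_def, Fin.lt_def, ones_index_val, ones_index_val]

variable (c : Composition n)

theorem lt_of_index_lt {a b : Fin n} (h : c.index a < c.index b) : a < b := by
  have hsize : c.sizeUpTo (c.index a + 1) ≤ c.sizeUpTo (c.index b) := c.monotone_sizeUpTo h
  exact Fin.lt_def.2
    ((c.lt_sizeUpTo_index_succ a).trans_le (hsize.trans (c.sizeUpTo_index_le b)))

theorem exists_eq_embedding (a : Fin n) : ∃ i p, a = c.embedding i p :=
  ⟨c.index a, c.invEmbedding a, (c.embedding_comp_inv a).symm⟩

/-- The strictly block upper triangular matrix with entries `x`, an element of the Lie algebra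
of `N`. -/
def upperMatrix (x : UpperPos c → F) : Matrix (Fin n) (Fin n) F :=
  Matrix.of fun a b => if h : c.index a < c.index b then x ⟨(a, b), h⟩ else 0

theorem upperMatrix_apply_of_lt (x : UpperPos c → F) {a b : Fin n} (h : c.index a < c.index b) :
    upperMatrix c x a b = x ⟨(a, b), h⟩ :=
  dif_pos h

theorem upperMatrix_apply_of_not_lt (x : UpperPos c → F) {a b : Fin n}
    (h : ¬ c.index a < c.index b) : upperMatrix c x a b = 0 :=
  dif_neg h

theorem unip_val (x : UpperPos c → F) : (unip c x).val = 1 + upperMatrix c x := rfl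

theorem unip_apply_self (x : UpperPos c → F) (a : Fin n) : (unip c x).val a a = 1 := by
  simp [unip_val, upperMatrix_apply_of_not_lt]

theorem unip_apply_of_lt (x : UpperPos c → F) {a b : Fin n} (h : c.index a < c.index b) :
    (unip c x).val a b = x ⟨(a, b), h⟩ := by
  rw [unip_val, Matrix.add_apply, upperMatrix_apply_of_lt c x h,
    Matrix.one_apply_ne (lt_of_index_lt c h).ne, zero_add]

theorem unip_apply_of_not_lt (x : UpperPos c → F) {a b : Fin n} (h : ¬ c.index a < c.index b) :
    (unip c x).val a b = (1 : Matrix (Fin n) (Fin n) F) a b := by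
  rw [unip_val, Matrix.add_apply, upperMatrix_apply_of_not_lt c x h, add_zero]

theorem unip_ones_apply_of_gt (x : UpperPos (Composition.ones n) → F) {a b : Fin n}
    (h : b < a) : (unip (Composition.ones n) x).val a b = 0 := by
  rw [unip_apply_of_not_lt _ _ (by rw [ones_index_lt_iff]; exact h.asymm),
    Matrix.one_apply_ne h.ne']

theorem unip_mem_maxCompact [IsUltrametricDist F] {c : Composition n} {x : UpperPos c → F}
    (hx : ∀ p, ‖x p‖ ≤ 1) : unip c x ∈ maxCompact F n := by
  refine mem_maxCompact_iff.2 ⟨fun a b => ?_, (congrArg norm (det_unipMatrix c x)).trans norm_one⟩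
  by_cases h : c.index a < c.index b
  · exact unip_apply_of_lt c x h ▸ hx _
  · exact unip_apply_of_not_lt c x h ▸ norm_one_apply_le a b

theorem unip_inv_apply_of_index_eq (x : UpperPos c → F) {a b : Fin n}
    (hab : c.index a = c.index b) :
    (unip c x)⁻¹.val a b = (1 : Matrix (Fin n) (Fin n) F) a b := by
  have htri : Matrix.BlockTriangular (unip c x).val c.index := fun i j hij => by
    rw [unip_apply_of_not_lt c x hij.asymm, Matrix.one_apply_ne (lt_of_index_lt c hij).ne']
  have : Invertible (unip c x).val := (unip c x).invertible
  have htri_inv : Matrix.BlockTriangular (unip c x)⁻¹.val c.index := by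
    rw [Matrix.coe_units_inv]
    exact Matrix.blockTriangular_inv_of_blockTriangular htri
  have hmul : (unip c x)⁻¹.val + upperMatrix c x * (unip c x)⁻¹.val = 1 := by
    simpa only [unip_val, add_mul, one_mul] using Units.mul_inv (unip c x)
  rw [← hmul, Matrix.add_apply, Matrix.mul_apply, Finset.sum_eq_zero, add_zero]
  intro k _
  by_cases h : c.index a < c.index k
  · rw [htri_inv (show c.index b < c.index k by rwa [← hab]), mul_zero]
  · rw [upperMatrix_apply_of_not_lt c x h, zero_mul]

theorem diagGL_mul_unip_mul_inv (s : Fin n → Fˣ) (x : UpperPos c → F) :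
    diagGL s * unip c x * (diagGL s)⁻¹ =
      unip c fun p => s p.1.1 * x p * (s p.1.2 : F)⁻¹ := by
  ext a b
  rw [diagGL_inv, Units.val_mul, Units.val_mul, diagGL_val, diagGL_val, Matrix.mul_diagonal,
    Matrix.diagonal_mul]
  by_cases h : c.index a < c.index b
  · rw [unip_apply_of_lt c _ h, unip_apply_of_lt c _ h]; simp
  · rw [unip_apply_of_not_lt c _ h, unip_apply_of_not_lt c _ h, Matrix.one_apply]
    split_ifs with h'
    · simp [h']
    · simp

/-- Conjugation by the powers of an element of small absolute value contracts `N(F)`. -/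
theorem exists_unip_eq_conj [IsUltrametricDist F] (x : UpperPos c → F) :
    ∃ s : Fin n → Fˣ, ∃ k ∈ maxCompact F n, unip c x = (diagGL s)⁻¹ * k * diagGL s := by
  obtain ⟨z, hz0, hz⟩ := NormedField.exists_norm_lt F
    (lt_min one_pos (inv_pos.2 (by positivity : (0 : ℝ) < ‖x‖ + 1)))
  have hz1 : ‖z‖ ≤ 1 := (hz.trans_le (min_le_left _ _)).le
  have hzx : ‖x‖ * ‖z‖ ≤ 1 := by
    calc ‖x‖ * ‖z‖ ≤ (‖x‖ + 1) * (‖x‖ + 1)⁻¹ := by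
          gcongr
          · exact le_add_of_nonneg_right zero_le_one
          · exact (hz.trans_le (min_le_right _ _)).le
      _ = 1 := mul_inv_cancel₀ (by positivity)
  let s : Fin n → Fˣ := fun a => (Units.mk0 z (norm_pos_iff.1 hz0) ^ (a : ℕ))⁻¹
  refine ⟨s, _, unip_mem_maxCompact (x := fun p => s p.1.1 * x p * (s p.1.2 : F)⁻¹)
    fun p => ?_, by rw [← diagGL_mul_unip_mul_inv]; group⟩
  have hlt : (p.1.1 : ℕ) < p.1.2 := lt_of_index_lt c p.2
  simp only [s, Units.val_inv_eq_inv_val, Units.val_pow_eq_pow_val, Units.val_mk0, norm_mul,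
    norm_inv, norm_pow, inv_inv]
  calc (‖z‖ ^ (p.1.1 : ℕ))⁻¹ * ‖x p‖ * ‖z‖ ^ (p.1.2 : ℕ)
      ≤ (‖z‖ ^ (p.1.1 : ℕ))⁻¹ * ‖x‖ * ‖z‖ ^ (p.1.1 + 1 : ℕ) := by
        gcongr ?_ * ?_ * ?_
        · exact norm_le_pi_norm x p
        · exact pow_le_pow_of_le_one hz0.le hz1 hlt
    _ = ‖x‖ * ‖z‖ := by rw [pow_succ]; field_simp
    _ ≤ 1 := hzx

theorem continuous_upperMatrix : Continuous (upperMatrix (F := F) c) := by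
  refine continuous_matrix fun a b => ?_
  by_cases h : c.index a < c.index b
  · simp_rw [upperMatrix_apply_of_lt c _ h]
    fun_prop
  · simp_rw [upperMatrix_apply_of_not_lt c _ h]
    fun_prop

theorem continuous_unip : Continuous (unip (F := F) c) := by
  have hval : Continuous fun x => (unip (F := F) c x).val :=
    continuous_const.add (continuous_upperMatrix c)
  refine Units.continuous_iff.2 ⟨hval, ?_⟩
  have hinv : (fun x => ((unip (F := F) c x)⁻¹).val) = fun x => (unip c x).val.adjugate := by
    funext x
    rw [Matrix.coe_units_inv, Matrix.inv_def, show (unip c x).val.det = 1 from det_unipMatrix c x,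
      Ring.inverse_one, one_smul]
  exact hinv ▸ hval.matrix_adjugate

theorem continuous_GL_apply (a b : Fin n) : Continuous fun g : GL (Fin n) F => g.val a b :=
  (continuous_id.matrix_elem a b).comp Units.continuous_val

theorem isClosedEmbedding_unip : Topology.IsClosedEmbedding (unip (F := F) c) :=
  Function.LeftInverse.isClosedEmbedding
    (f := fun (g : GL (Fin n) F) (p : UpperPos c) => g.val p.1.1 p.1.2)
    (fun x => funext fun p => unip_apply_of_lt c x p.2)
    (continuous_pi fun _ => continuous_GL_apply _ _) (continuous_unip c)

end Unipotent

section LeviEmbedding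

variable {F : Type*} [NontriviallyNormedField F] {n : ℕ} (c : Composition n)

/-- The matrices that are block diagonal for the partition `c`. -/
def IsBlockDiagonal (A : Matrix (Fin n) (Fin n) F) : Prop :=
  ∀ a b, c.index a ≠ c.index b → A a b = 0

theorem isBlockDiagonal_one : IsBlockDiagonal c (1 : Matrix (Fin n) (Fin n) F) :=
  fun _ _ h => Matrix.one_apply_ne fun hab => h (congrArg _ hab)

theorem leviEmb_apply (m : Levi F c) (a b : Fin n) : (leviEmb c m).val a b =
    Matrix.blockDiagonal' (fun i => (m i).val) (c.blocksFinEquiv.symm a)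
      (c.blocksFinEquiv.symm b) := rfl

theorem isBlockDiagonal_leviEmb (m : Levi F c) : IsBlockDiagonal c (leviEmb c m).val :=
  fun a b h => (leviEmb_apply c m a b).trans (Matrix.blockDiagonal'_apply_ne _ _ _ h)

theorem blocksFinEquiv_symm_embedding (i : Fin c.length) (p : Fin (c.blocksFun i)) :
    c.blocksFinEquiv.symm (c.embedding i p) = ⟨i, p⟩ :=
  c.blocksFinEquiv.symm_apply_eq.2 rfl

theorem leviEmb_apply_embedding (m : Levi F c) (i : Fin c.length) (p q : Fin (c.blocksFun i)) :
    (leviEmb c m).val (c.embedding i p) (c.embedding i q) = (m i).val p q := by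
  rw [leviEmb_apply, blocksFinEquiv_symm_embedding, blocksFinEquiv_symm_embedding,
    Matrix.blockDiagonal'_apply_eq]

theorem IsBlockDiagonal.ext {A B : Matrix (Fin n) (Fin n) F} {c : Composition n}
    (hA : IsBlockDiagonal c A) (hB : IsBlockDiagonal c B)
    (h : ∀ i p q, A (c.embedding i p) (c.embedding i q) = B (c.embedding i p) (c.embedding i q)) :
    A = B := by
  ext a b
  obtain ⟨i, p, rfl⟩ := exists_eq_embedding c a
  obtain ⟨j, q, rfl⟩ := exists_eq_embedding c b
  by_cases hij : i = j
  · subst hij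
    exact h i p q
  · have hne : c.index (c.embedding i p) ≠ c.index (c.embedding j q) := by simpa using hij
    rw [hA _ _ hne, hB _ _ hne]

/-- The maximal compact subgroup `M(𝒪_F)` of the Levi subgroup. -/
noncomputable def leviMaxCompact (F : Type*) [NontriviallyNormedField F] [IsUltrametricDist F]
    {n : ℕ} (c : Composition n) : Subgroup (Levi F c) :=
  Subgroup.pi Set.univ fun i => maxCompact F (c.blocksFun i)

theorem mem_leviMaxCompact [IsUltrametricDist F] {c : Composition n} {m : Levi F c} :
    m ∈ leviMaxCompact F c ↔ ∀ i, m i ∈ maxCompact F (c.blocksFun i) := by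
  simp [leviMaxCompact, Subgroup.mem_pi]

theorem norm_leviEmb_apply_le (m : Levi F c) {C : ℝ} (hC : 0 ≤ C)
    (h : ∀ i p q, ‖(m i).val p q‖ ≤ C) (a b : Fin n) : ‖(leviEmb c m).val a b‖ ≤ C := by
  obtain ⟨i, p, rfl⟩ := exists_eq_embedding c a
  obtain ⟨j, q, rfl⟩ := exists_eq_embedding c b
  by_cases hij : i = j
  · subst hij
    rw [leviEmb_apply_embedding]
    exact h i p q
  · rw [isBlockDiagonal_leviEmb c m _ _ (by simpa using hij), norm_zero]
    exact hC

theorem leviEmb_mem_maxCompact [IsUltrametricDist F] {m : Levi F c}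
    (h : m ∈ leviMaxCompact F c) : leviEmb c m ∈ maxCompact F n := by
  have hbound : ∀ m ∈ leviMaxCompact F c, ∀ a b, ‖(leviEmb c m).val a b‖ ≤ 1 := fun m hm =>
    norm_leviEmb_apply_le c m zero_le_one fun i =>
      norm_apply_le_one_of_mem_maxCompact (mem_leviMaxCompact.1 hm i)
  exact mem_maxCompact_of_integral (hbound m h) (map_inv (leviEmb c) m ▸ hbound _ (inv_mem h))

/-- The coordinates in block `i` of a point of the diagonal torus. -/
def blockCoords (t : Fin n → Fˣ) (i : Fin c.length) (p : Fin (c.blocksFun i)) : Fˣ :=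
  t (c.embedding i p)

theorem torusToLevi_apply (t : Fin n → Fˣ) (i : Fin c.length) :
    torusToLevi c t i = diagGL (blockCoords c t i) := rfl

theorem leviEmb_torusToLevi (t : Fin n → Fˣ) : leviEmb c (torusToLevi c t) = diagGL t := by
  refine Units.ext (IsBlockDiagonal.ext (isBlockDiagonal_leviEmb c _)
    (fun a b h => Matrix.diagonal_apply_ne _ fun hab => h (congrArg _ hab)) fun i p q => ?_)
  rw [leviEmb_apply_embedding, torusToLevi_apply]
  simp [blockCoords, Matrix.diagonal_apply]

theorem exists_blockCoords_eq (t : ∀ i, Fin (c.blocksFun i) → Fˣ) :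
    ∃ s : Fin n → Fˣ, blockCoords c s = t := by
  refine ⟨fun a => t (c.blocksFinEquiv.symm a).1 (c.blocksFinEquiv.symm a).2, ?_⟩
  funext i p
  change (fun x : Σ i, Fin (c.blocksFun i) => t x.1 x.2) _ = t i p
  rw [blocksFinEquiv_symm_embedding]

/-- The coordinates of a tuple of upper triangular unipotent matrices, one for each block. -/
abbrev LeviUpper (F : Type*) {n : ℕ} (c : Composition n) : Type _ :=
  ∀ i, UpperPos (Composition.ones (c.blocksFun i)) → F

/-- The tuple of upper triangular unipotent matrices with coordinates `y`. -/
def unipLevi (y : LeviUpper F c) : Levi F c :=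
  fun i => unip (Composition.ones (c.blocksFun i)) (y i)

theorem exists_unipLevi_eq_conj [IsUltrametricDist F] (y : LeviUpper F c) :
    ∃ s : Fin n → Fˣ, ∃ k ∈ leviMaxCompact F c,
      unipLevi c y = (torusToLevi c s)⁻¹ * k * torusToLevi c s := by
  choose t k hk h using fun i => exists_unip_eq_conj (Composition.ones (c.blocksFun i)) (y i)
  obtain ⟨s, rfl⟩ := exists_blockCoords_eq c t
  exact ⟨s, k, mem_leviMaxCompact.2 hk, funext h⟩

theorem isClosedEmbedding_unipLevi : Topology.IsClosedEmbedding (unipLevi (F := F) c) :=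
  Function.LeftInverse.isClosedEmbedding
    (f := fun (m : Levi F c) i (p : UpperPos (Composition.ones (c.blocksFun i))) =>
      (m i).val p.1.1 p.1.2)
    (fun y => funext fun i => funext fun p => unip_apply_of_lt _ (y i) p.2)
    (continuous_pi fun i => continuous_pi fun _ =>
      (continuous_GL_apply _ _).comp (continuous_apply i))
    (continuous_pi fun i => (continuous_unip _).comp (continuous_apply i))

end LeviEmbedding

/-! ### The adjoint action on the unipotent radical -/

section Adjoint

variable {F : Type*} [NontriviallyNormedField F] {n : ℕ} (c : Composition n)

theorem sum_upperPos {f : Fin n → Fin n → F} (hf : ∀ a b, ¬ c.index a < c.index b → f a b = 0) :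
    ∑ x : UpperPos c, f x.1.1 x.1.2 = ∑ a, ∑ b, f a b := by
  rw [← Fintype.sum_prod_type', ← Finset.sum_subtype
    (Finset.univ.filter fun x : Fin n × Fin n => c.index x.1 < c.index x.2) (by simp)
    (fun x : Fin n × Fin n => f x.1 x.2)]
  exact Finset.sum_filter_of_ne fun x _ hx => not_not.1 fun h => hx (hf _ _ h)

/-- The matrix of `X ↦ A X B` on strictly block upper triangular matrices, in the basis of
elementary matrices. -/
def biMatrix (A B : Matrix (Fin n) (Fin n) F) : Matrix (UpperPos c) (UpperPos c) F :=
  Matrix.of fun x y => A x.1.1 y.1.1 * B y.1.2 x.1.2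

theorem adMatrix_eq (m : Levi F c) :
    adMatrix c m = biMatrix c (leviEmb c m).val (leviEmb c m⁻¹).val := by
  rw [map_inv]; rfl

theorem biMatrix_diagonal (d e : Fin n → F) :
    biMatrix c (Matrix.diagonal d) (Matrix.diagonal e) =
      Matrix.diagonal fun p : UpperPos c => d p.1.1 * e p.1.2 := by
  ext x y
  obtain rfl | h := eq_or_ne x y
  · simp [biMatrix]
  · rw [Matrix.diagonal_apply_ne _ h, biMatrix, Matrix.of_apply]
    by_cases hrow : x.1.1 = y.1.1
    · have hcol : y.1.2 ≠ x.1.2 := fun hcol => h (Subtype.ext (Prod.ext hrow hcol.symm))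
      rw [Matrix.diagonal_apply_ne _ hcol, mul_zero]
    · rw [Matrix.diagonal_apply_ne _ hrow, zero_mul]

theorem biMatrix_one : biMatrix c (1 : Matrix (Fin n) (Fin n) F) 1 = 1 := by
  simpa using biMatrix_diagonal c (1 : Fin n → F) 1

variable {c} {A B : Matrix (Fin n) (Fin n) F}

theorem IsBlockDiagonal.mul_mul_eq_zero (hA : IsBlockDiagonal c A) (hB : IsBlockDiagonal c B)
    {a a' b' b : Fin n} (h : ¬ (c.index a < c.index b ↔ c.index a' < c.index b')) :
    A a a' * B b' b = 0 := by
  by_cases ha : c.index a = c.index a'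
  · rw [hB b' b fun hb => h (by rw [ha, hb]), mul_zero]
  · rw [hA _ _ ha, zero_mul]

theorem IsBlockDiagonal.biMatrix_mul (hA : IsBlockDiagonal c A) (hB : IsBlockDiagonal c B)
    (A' B' : Matrix (Fin n) (Fin n) F) :
    biMatrix c A B * biMatrix c A' B' = biMatrix c (A * A') (B' * B) := by
  ext x y
  simp only [Matrix.mul_apply, biMatrix, Matrix.of_apply]
  rw [sum_upperPos c (f := fun a b => A x.1.1 a * B b x.1.2 * (A' a y.1.1 * B' y.1.2 b)),
    Finset.sum_mul_sum]
  · exact Finset.sum_congr rfl fun a _ => Finset.sum_congr rfl fun b _ => by ring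
  · intro a b h
    rw [hA.mul_mul_eq_zero hB fun he => h (he.1 x.2), zero_mul]

theorem IsBlockDiagonal.upperMatrix_biMatrix_mulVec (hA : IsBlockDiagonal c A)
    (hB : IsBlockDiagonal c B) (x : UpperPos c → F) :
    upperMatrix c ((biMatrix c A B).mulVec x) = A * upperMatrix c x * B := by
  ext a b
  have hentry : (A * upperMatrix c x * B) a b =
      ∑ a', ∑ b', A a a' * B b' b * upperMatrix c x a' b' := by
    rw [Matrix.mul_apply, Finset.sum_comm]
    simp_rw [Matrix.mul_apply, Finset.sum_mul, mul_right_comm]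
  rw [hentry]
  by_cases h : c.index a < c.index b
  · rw [upperMatrix_apply_of_lt c _ h, ← sum_upperPos c
      fun a' b' h' => by rw [upperMatrix_apply_of_not_lt c x h', mul_zero]]
    exact Finset.sum_congr rfl fun y _ =>
      congrArg (biMatrix c A B ⟨(a, b), h⟩ y * ·) (upperMatrix_apply_of_lt c x y.2).symm
  · rw [upperMatrix_apply_of_not_lt c _ h]
    refine (Finset.sum_eq_zero fun a' _ => Finset.sum_eq_zero fun b' _ => ?_).symm
    by_cases h' : c.index a' < c.index b'
    · rw [hA.mul_mul_eq_zero hB fun he => h (he.2 h'), zero_mul]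
    · rw [upperMatrix_apply_of_not_lt c x h', mul_zero]

variable (c)

/-- The adjoint action of `M` on the Lie algebra of `N`. -/
def adHom : Levi F c →* Matrix (UpperPos c) (UpperPos c) F where
  toFun := adMatrix c
  map_one' := by
    rw [adMatrix_eq, inv_one, map_one]
    exact biMatrix_one c
  map_mul' m m' := by
    rw [adMatrix_eq, adMatrix_eq, adMatrix_eq,
      (isBlockDiagonal_leviEmb c m).biMatrix_mul (isBlockDiagonal_leviEmb c _), mul_inv_rev,
      map_mul, map_mul, Units.val_mul, Units.val_mul]

/-- The action of `M` on the strictly block upper triangular matrices by left multiplication. -/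
def leftMulHom : Levi F c →* Matrix (UpperPos c) (UpperPos c) F where
  toFun m := biMatrix c (leviEmb c m).val 1
  map_one' := by
    rw [map_one]
    exact biMatrix_one c
  map_mul' m m' := by
    rw [(isBlockDiagonal_leviEmb c m).biMatrix_mul (isBlockDiagonal_one c), mul_one, map_mul,
      Units.val_mul]

theorem adHom_apply (m : Levi F c) :
    adHom c m = biMatrix c (leviEmb c m).val (leviEmb c m⁻¹).val :=
  adMatrix_eq c m

theorem leftMulHom_apply (m : Levi F c) :
    leftMulHom c m = biMatrix c (leviEmb c m).val 1 := rfl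

theorem leviEmb_mul_unip (m : Levi F c) (x : UpperPos c → F) :
    leviEmb c m * unip c x = unip c ((adHom c m).mulVec x) * leviEmb c m := by
  refine Units.ext ?_
  rw [Units.val_mul, Units.val_mul, unip_val, unip_val, adHom_apply,
    (isBlockDiagonal_leviEmb c m).upperMatrix_biMatrix_mulVec (isBlockDiagonal_leviEmb c _),
    mul_add, add_mul, mul_assoc _ _ (leviEmb c m).val, map_inv, Units.inv_mul, mul_one, one_mul,
    mul_one]

theorem leviEmb_mul_unip_val (m : Levi F c) (x : UpperPos c → F) :
    (leviEmb c m * unip c x).val =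
      (leviEmb c m).val + upperMatrix c ((leftMulHom c m).mulVec x) := by
  rw [leftMulHom_apply,
    (isBlockDiagonal_leviEmb c m).upperMatrix_biMatrix_mulVec (isBlockDiagonal_one c),
    Units.val_mul, unip_val, mul_add, mul_one, mul_one]

theorem norm_biMatrix_apply_le_one [IsUltrametricDist F] {A B : Matrix (Fin n) (Fin n) F}
    (hA : ∀ a b, ‖A a b‖ ≤ 1) (hB : ∀ a b, ‖B a b‖ ≤ 1) (p q : UpperPos c) :
    ‖biMatrix c A B p q‖ ≤ 1 := by
  rw [biMatrix, Matrix.of_apply, norm_mul]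
  exact mul_le_one₀ (hA _ _) (norm_nonneg _) (hB _ _)

theorem norm_adHom_apply_le_one [IsUltrametricDist F] {m : Levi F c}
    (h : m ∈ leviMaxCompact F c) (p q : UpperPos c) : ‖adHom c m p q‖ ≤ 1 := by
  rw [adHom_apply]
  exact norm_biMatrix_apply_le_one c
    (norm_apply_le_one_of_mem_maxCompact (leviEmb_mem_maxCompact c h))
    (norm_apply_le_one_of_mem_maxCompact (leviEmb_mem_maxCompact c (inv_mem h))) p q

theorem norm_leftMulHom_apply_le_one [IsUltrametricDist F] {m : Levi F c}
    (h : m ∈ leviMaxCompact F c) (p q : UpperPos c) : ‖leftMulHom c m p q‖ ≤ 1 :=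
  norm_biMatrix_apply_le_one c
    (norm_apply_le_one_of_mem_maxCompact (leviEmb_mem_maxCompact c h)) norm_one_apply_le p q

theorem map_unipLevi_eq_one [IsUltrametricDist F] {M : Type*} [CommMonoid M] {χ : Levi F c →* M}
    (hχ : ∀ k ∈ leviMaxCompact F c, χ k = 1) (y : LeviUpper F c) : χ (unipLevi c y) = 1 := by
  obtain ⟨s, k, hk, h⟩ := exists_unipLevi_eq_conj c y
  rw [h, map_mul, map_mul, hχ k hk, mul_one, ← map_mul, inv_mul_cancel, map_one]

/-! ### The modular character -/

/-- The modular character as a homomorphism. -/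
def modularHom : Levi F c →* ℝ := (normHom.toMonoidHom.comp Matrix.detMonoidHom).comp (adHom c)

theorem modularHom_apply (m : Levi F c) : modularHom c m = modular c m := rfl

theorem modular_mul (m m' : Levi F c) : modular c (m * m') = modular c m * modular c m' :=
  map_mul (modularHom c) m m'

theorem modular_inv_mul_modular (m : Levi F c) : modular c m⁻¹ * modular c m = 1 := by
  rw [← modular_mul, inv_mul_cancel, ← modularHom_apply, map_one]

theorem modular_pos (m : Levi F c) : 0 < modular c m :=
  (norm_nonneg _).lt_of_ne' (right_ne_zero_of_mul_eq_one (modular_inv_mul_modular c m))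

theorem modular_of_mem_leviMaxCompact [IsUltrametricDist F] {m : Levi F c}
    (h : m ∈ leviMaxCompact F c) : modular c m = 1 := by
  have hmul : (adHom c m).det * (adHom c m⁻¹).det = 1 := by
    rw [← Matrix.det_mul, ← map_mul, mul_inv_cancel, map_one, Matrix.det_one]
  exact norm_eq_one_of_mul_eq_one (norm_det_le_one (norm_adHom_apply_le_one c h))
    (norm_det_le_one (norm_adHom_apply_le_one c (inv_mem h))) hmul

theorem modular_unipLevi [IsUltrametricDist F] (y : LeviUpper F c) :
    modular c (unipLevi c y) = 1 :=
  map_unipLevi_eq_one c (χ := modularHom c) (fun _ => modular_of_mem_leviMaxCompact c) y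

theorem modular_torusToLevi (t : Fin n → Fˣ) : modular c (torusToLevi c t) =
    ∏ p : UpperPos c, ‖(t p.1.1 : F)‖ / ‖(t p.1.2 : F)‖ := by
  rw [modular, adMatrix_eq, map_inv, leviEmb_torusToLevi, diagGL_inv, diagGL_val, diagGL_val,
    biMatrix_diagonal, Matrix.det_diagonal, norm_prod]
  simp [div_eq_mul_inv]

/-- The positions above the diagonal lie either in a diagonal block or above the diagonal
blocks; this is the inclusion of both kinds. -/
def blockPos : (Σ i, UpperPos (Composition.ones (c.blocksFun i))) ⊕ UpperPos c →
    UpperPos (Composition.ones n)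
  | .inl x => ⟨(c.embedding x.1 x.2.1.1, c.embedding x.1 x.2.1.2),
      ones_index_lt_iff.2 ((c.embedding x.1).lt_iff_lt.2 (ones_index_lt_iff.1 x.2.2))⟩
  | .inr x => ⟨x.1, ones_index_lt_iff.2 (lt_of_index_lt c x.2)⟩

theorem blockPos_inl_ne_inr (x : Σ i, UpperPos (Composition.ones (c.blocksFun i)))
    (y : UpperPos c) : blockPos c (.inl x) ≠ blockPos c (.inr y) := by
  intro h
  obtain ⟨hrow, hcol⟩ := Prod.ext_iff.1 (congrArg Subtype.val h)
  have hrow_index : x.1 = c.index y.1.1 := by simpa [blockPos] using congrArg c.index hrow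
  have hcol_index : x.1 = c.index y.1.2 := by simpa [blockPos] using congrArg c.index hcol
  exact y.2.ne (hrow_index.symm.trans hcol_index)

theorem blockPos_injective : Function.Injective (blockPos c) := by
  rintro (⟨i, ⟨⟨p, q⟩, hpq⟩⟩ | x) (⟨j, ⟨⟨p', q'⟩, hpq'⟩⟩ | y) h
  · obtain ⟨hp, hq⟩ := Prod.ext_iff.1 (congrArg Subtype.val h)
    obtain rfl : i = j := by simpa [blockPos] using congrArg c.index hp
    obtain rfl := (c.embedding i).injective hp
    obtain rfl := (c.embedding i).injective hq
    rfl
  · exact absurd (by rw [h]) (blockPos_inl_ne_inr c _ y)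
  · exact absurd (by rw [h]) (blockPos_inl_ne_inr c _ x)
  · exact congrArg Sum.inr (Subtype.ext (congrArg (fun p => p.1) h))

theorem blockPos_surjective : Function.Surjective (blockPos c) := by
  rintro ⟨⟨a, b⟩, hab⟩
  have hlt := ones_index_lt_iff.1 hab
  by_cases h : c.index a < c.index b
  · exact ⟨.inr ⟨(a, b), h⟩, rfl⟩
  · obtain ⟨i, p, rfl⟩ := exists_eq_embedding c a
    obtain ⟨j, q, rfl⟩ := exists_eq_embedding c b
    have hle : ¬ j < i := fun hji => hlt.not_gt (lt_of_index_lt c (by simpa using hji))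
    obtain rfl : i = j := le_antisymm (not_lt.1 hle) (not_lt.1 (by simpa using h))
    exact ⟨.inl ⟨i, ⟨(p, q), ones_index_lt_iff.2 ((c.embedding i).lt_iff_lt.1 hlt)⟩⟩, rfl⟩

/-- The bijection underlying the factorisation of the full unipotent group of `GL_n` into those of
the blocks of `M` and `N`. -/
noncomputable def upperPosEquiv :
    (Σ i, UpperPos (Composition.ones (c.blocksFun i))) ⊕ UpperPos c ≃
      UpperPos (Composition.ones n) :=
  Equiv.ofBijective (blockPos c) ⟨blockPos_injective c, blockPos_surjective c⟩

theorem modular_ones_torusToLevi (t : Fin n → Fˣ) :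
    modular (Composition.ones n) (torusToLevi (Composition.ones n) t) =
      (∏ i, modular (Composition.ones (c.blocksFun i))
        (torusToLevi (Composition.ones (c.blocksFun i)) (blockCoords c t i))) *
        modular c (torusToLevi c t) := by
  simp_rw [modular_torusToLevi]
  rw [← (upperPosEquiv c).prod_comp, Fintype.prod_sum_type, Fintype.prod_sigma]
  rfl

end Adjoint

/-! ### Haar measures on unipotent radicals -/

theorem norm_mulVec_le_one {F : Type*} [NontriviallyNormedField F] [IsUltrametricDist F]
    {ι : Type*} [Fintype ι] {A : Matrix ι ι F} (hA : ∀ i j, ‖A i j‖ ≤ 1)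
    {x : ι → F} (hx : ‖x‖ ≤ 1) : ‖A.mulVec x‖ ≤ 1 := by
  refine (pi_norm_le_iff_of_nonneg zero_le_one).2 fun i =>
    IsUltrametricDist.norm_sum_le_of_forall_le_of_nonneg zero_le_one fun j _ => ?_
  rw [norm_mul]
  exact mul_le_one₀ (hA i j) (norm_nonneg _) ((norm_le_pi_norm x j).trans hx)

section Haar

variable {F : Type*} [NontriviallyNormedField F] [ProperSpace F] [MeasurableSpace F]
  [BorelSpace F]

instance isAddHaarMeasure_haarF : (haarF F).IsAddHaarMeasure :=
  inferInstanceAs (Measure.addHaarMeasure (unitBall F)).IsAddHaarMeasure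

theorem haarF_closedBall : haarF F (Metric.closedBall 0 1) = 1 :=
  Measure.addHaarMeasure_self (K₀ := unitBall F)

theorem pi_haarF_closedBall {ι : Type*} [Fintype ι] :
    Measure.pi (fun _ : ι => haarF F) (Metric.closedBall 0 1) = 1 := by
  simp [Measure.pi_closedBall _ _ zero_le_one, haarF_closedBall]

/-- The automorphism `x ↦ A x` of `F^ι`. -/
def mulVecEquiv {ι : Type*} [Fintype ι] [DecidableEq ι] (A : (Matrix ι ι F)ˣ) :
    (ι → F) ≃ₜ+ (ι → F) where
  toFun := A.val.mulVec
  invFun := A⁻¹.val.mulVec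
  left_inv x := by rw [Matrix.mulVec_mulVec, Units.inv_mul, Matrix.one_mulVec]
  right_inv x := by rw [Matrix.mulVec_mulVec, Units.mul_inv, Matrix.one_mulVec]
  map_add' := A.val.mulVec_add
  continuous_toFun := continuous_const.matrix_mulVec continuous_id
  continuous_invFun := continuous_const.matrix_mulVec continuous_id

variable {ι : Type*} [Fintype ι] [DecidableEq ι]

/-- The factor by which an invertible matrix scales the Haar measure of `F^ι`. -/
noncomputable def haarScale : (Matrix ι ι F)ˣ →* NNReal where
  toFun A := addEquivAddHaarChar (mulVecEquiv A)
  map_one' := by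
    rw [← addEquivAddHaarChar_refl (G := ι → F)]
    exact congrArg _ (ContinuousAddEquiv.ext fun x => Matrix.one_mulVec x)
  map_mul' A B := by
    rw [mul_comm, ← addEquivAddHaarChar_trans]
    exact congrArg _ (ContinuousAddEquiv.ext fun x => (Matrix.mulVec_mulVec x A.val B.val).symm)

theorem haarScale_eq_one_of_integral [IsUltrametricDist F] {A : (Matrix ι ι F)ˣ}
    (hA : ∀ i j, ‖A.val i j‖ ≤ 1) (hA_inv : ∀ i j, ‖A⁻¹.val i j‖ ≤ 1) : haarScale A = 1 := by
  have hpre : mulVecEquiv A ⁻¹' Metric.closedBall 0 1 = Metric.closedBall 0 1 := by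
    ext x
    simp only [Set.mem_preimage, mem_closedBall_zero_iff]
    refine ⟨fun h => ?_, norm_mulVec_le_one hA⟩
    rw [← (mulVecEquiv A).symm_apply_apply x]
    exact norm_mulVec_le_one hA_inv h
  have hscale := addEquivAddHaarChar_smul_preimage (Measure.pi fun _ : ι => haarF F)
    (X := Metric.closedBall 0 1) (mulVecEquiv A)
  rw [hpre, pi_haarF_closedBall, ENNReal.smul_def, smul_eq_mul, mul_one] at hscale
  exact_mod_cast hscale

theorem integral_comp_mulVec {A : (Matrix ι ι F)ˣ} (hA : haarScale A = 1) (f : (ι → F) → ℂ) :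
    ∫ x, f (A.val.mulVec x) ∂(Measure.pi fun _ => haarF F) =
      ∫ x, f x ∂(Measure.pi fun _ => haarF F) := by
  have hmap := addEquivAddHaarChar_smul_map (Measure.pi fun _ : ι => haarF F) (mulVecEquiv A)
  rw [show addEquivAddHaarChar (mulVecEquiv A) = 1 from hA, one_smul] at hmap
  exact (MeasurePreserving.mk (mulVecEquiv A).toHomeomorph.measurable hmap).integral_comp
    (mulVecEquiv A).toHomeomorph.measurableEmbedding f

end Haar

theorem measurePreserving_of_measure_preimage_eq {G H : Type*} [AddCommGroup G]
    [TopologicalSpace G] [IsTopologicalAddGroup G] [MeasurableSpace G] [BorelSpace G]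
    [AddCommGroup H] [TopologicalSpace H] [IsTopologicalAddGroup H] [MeasurableSpace H]
    [BorelSpace H] [LocallyCompactSpace H] [SecondCountableTopology H] (e : G ≃ₜ+ H)
    (μ : Measure G) (ν : Measure H) [μ.IsAddHaarMeasure] [ν.IsAddHaarMeasure] {s : Set H}
    (hzero : ν s ≠ 0) (htop : ν s ≠ ⊤) (h : μ (e ⁻¹' s) = ν s) : MeasurePreserving e μ ν := by
  refine ⟨e.toHomeomorph.measurable, ?_⟩
  have := ContinuousAddEquiv.isAddHaarMeasure_map μ e
  have hmap := Measure.isAddLeftInvariant_eq_smul (μ.map e) ν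
  have hscale : (μ.map e) s = (Measure.addHaarScalarFactor (μ.map e) ν • ν) s := by rw [← hmap]
  rw [show (μ.map e) s = μ (e ⁻¹' s) from e.toHomeomorph.measurableEmbedding.map_apply _ _, h,
    Measure.smul_apply, ENNReal.smul_def, smul_eq_mul, eq_comm,
    ENNReal.mul_eq_right hzero htop] at hscale
  rw [hmap, show Measure.addHaarScalarFactor (μ.map e) ν = 1 by exact_mod_cast hscale, one_smul]

section JoinUpper

variable {F : Type*} [NontriviallyNormedField F] {n : ℕ} (c : Composition n)

/-- The entries above the diagonal of an upper triangular matrix, assembled from those of the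
diagonal blocks and those above the diagonal blocks. -/
noncomputable def joinUpper :
    LeviUpper F c × (UpperPos c → F) ≃ₜ+ (UpperPos (Composition.ones n) → F) where
  toFun z p := Sum.elim (fun q => z.1 q.1 q.2) z.2 ((upperPosEquiv c).symm p)
  invFun w := (fun i q => w (upperPosEquiv c (.inl ⟨i, q⟩)), fun p => w (upperPosEquiv c (.inr p)))
  left_inv z := by simp
  right_inv w := by
    funext p
    obtain ⟨q | q, rfl⟩ := (upperPosEquiv c).surjective p <;> simp
  map_add' z w := by
    funext p
    obtain ⟨q | q, rfl⟩ := (upperPosEquiv c).surjective p <;> simp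
  continuous_toFun := by
    refine continuous_pi fun p => ?_
    obtain ⟨q | q, rfl⟩ := (upperPosEquiv c).surjective p <;>
      simp only [Equiv.symm_apply_apply, Sum.elim_inl, Sum.elim_inr] <;> fun_prop
  continuous_invFun := by fun_prop

variable (z : LeviUpper F c × (UpperPos c → F))

theorem joinUpper_inl (i : Fin c.length) (q : UpperPos (Composition.ones (c.blocksFun i))) :
    joinUpper c z (upperPosEquiv c (.inl ⟨i, q⟩)) = z.1 i q := by
  change Sum.elim _ _ ((upperPosEquiv c).symm _) = _
  simp

theorem joinUpper_inr (q : UpperPos c) : joinUpper c z (upperPosEquiv c (.inr q)) = z.2 q := by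
  change Sum.elim _ _ ((upperPosEquiv c).symm _) = _
  simp

theorem norm_joinUpper_le_iff {r : ℝ} (hr : 0 ≤ r) : ‖joinUpper c z‖ ≤ r ↔ ‖z‖ ≤ r := by
  rw [norm_prod_le_iff, pi_norm_le_iff_of_nonneg hr, pi_norm_le_iff_of_nonneg hr,
    pi_norm_le_iff_of_nonneg hr, ← (upperPosEquiv c).forall_congr_right, Sum.forall, Sigma.forall]
  simp only [joinUpper_inl, joinUpper_inr, pi_norm_le_iff_of_nonneg hr]

theorem unip_joinUpper_val : (unip (Composition.ones n) (joinUpper c z)).val =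
    (leviEmb c (unipLevi c z.1)).val + upperMatrix c z.2 := by
  ext a b
  rw [Matrix.add_apply]
  obtain ⟨i, p, rfl⟩ := exists_eq_embedding c a
  obtain ⟨j, q, rfl⟩ := exists_eq_embedding c b
  rcases lt_trichotomy i j with hij | rfl | hij
  · have hlt : c.index (c.embedding i p) < c.index (c.embedding j q) := by simpa using hij
    rw [isBlockDiagonal_leviEmb c _ _ _ hlt.ne, zero_add, upperMatrix_apply_of_lt c _ hlt,
      unip_apply_of_lt _ _ (ones_index_lt_iff.2 (lt_of_index_lt c hlt))]
    exact joinUpper_inr c z ⟨_, hlt⟩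
  · rw [leviEmb_apply_embedding, upperMatrix_apply_of_not_lt c _ (by simp), add_zero, unipLevi]
    by_cases hpq : p < q
    · rw [unip_apply_of_lt _ _ (ones_index_lt_iff.2 hpq),
        unip_apply_of_lt _ _ (ones_index_lt_iff.2 ((c.embedding i).lt_iff_lt.2 hpq))]
      exact joinUpper_inl c z i ⟨(p, q), ones_index_lt_iff.2 hpq⟩
    · rw [unip_apply_of_not_lt _ _ (by rwa [ones_index_lt_iff, OrderEmbedding.lt_iff_lt]),
        unip_apply_of_not_lt _ _ (by rwa [ones_index_lt_iff]),
        Matrix.one_apply, Matrix.one_apply]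
      simp
  · have hlt : c.index (c.embedding j q) < c.index (c.embedding i p) := by simpa using hij
    rw [isBlockDiagonal_leviEmb c _ _ _ hlt.ne', zero_add,
      upperMatrix_apply_of_not_lt c _ hlt.asymm, unip_ones_apply_of_gt _ (lt_of_index_lt c hlt)]

end JoinUpper

section LeviMeasure

variable {F : Type*} [NontriviallyNormedField F] [ProperSpace F] [MeasurableSpace F]
  [BorelSpace F] {n : ℕ} (c : Composition n)

/-- The Haar measure on tuples of upper triangular unipotent matrices that gives the integral ones
measure `1`. -/
noncomputable def leviUpperMeasure (F : Type*) [NontriviallyNormedField F] [ProperSpace F]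
    [MeasurableSpace F] [BorelSpace F] {n : ℕ} (c : Composition n) : Measure (LeviUpper F c) :=
  Measure.pi fun _ => Measure.pi fun _ => haarF F

instance isAddHaarMeasure_leviUpperMeasure : (leviUpperMeasure F c).IsAddHaarMeasure :=
  Measure.pi.isAddHaarMeasure fun _ => Measure.pi fun _ => haarF F

instance sigmaFinite_leviUpperMeasure : SigmaFinite (leviUpperMeasure F c) :=
  inferInstanceAs (SigmaFinite (Measure.pi _))

theorem leviUpperMeasure_closedBall : leviUpperMeasure F c (Metric.closedBall 0 1) = 1 := by
  rw [leviUpperMeasure, Measure.pi_closedBall _ _ zero_le_one]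
  exact Finset.prod_eq_one fun i _ => pi_haarF_closedBall

theorem measurePreserving_joinUpper : MeasurePreserving (joinUpper (F := F) c)
    ((leviUpperMeasure F c).prod (Measure.pi fun _ => haarF F)) (Measure.pi fun _ => haarF F) := by
  have : ((leviUpperMeasure F c).prod
      (Measure.pi fun _ : UpperPos c => haarF F)).IsAddHaarMeasure :=
    Measure.prod.instIsAddHaarMeasure _ _
  refine measurePreserving_of_measure_preimage_eq _ _ _ (s := Metric.closedBall 0 1)
    (by simp [pi_haarF_closedBall]) (by simp [pi_haarF_closedBall]) ?_
  have hpre : joinUpper (F := F) c ⁻¹' Metric.closedBall 0 1 =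
      Metric.closedBall 0 1 ×ˢ Metric.closedBall 0 1 := by
    ext z
    rw [closedBall_prod_same, ← Prod.zero_eq_mk]
    simpa only [Set.mem_preimage, mem_closedBall_zero_iff] using
      norm_joinUpper_le_iff c z zero_le_one
  rw [hpre, Measure.prod_prod, leviUpperMeasure_closedBall, pi_haarF_closedBall,
    pi_haarF_closedBall, one_mul]

theorem haarScale_leftMulHom_unipLevi [IsUltrametricDist F] (y : LeviUpper F c) :
    haarScale ((leftMulHom c).toHomUnits (unipLevi c y)) = 1 := by
  have hcompact (k : Levi F c) (hk : k ∈ leviMaxCompact F c) :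
      (haarScale.comp (leftMulHom c).toHomUnits) k = 1 := by
    refine haarScale_eq_one_of_integral (norm_leftMulHom_apply_le_one c hk) ?_
    rw [← map_inv]
    exact norm_leftMulHom_apply_le_one c (inv_mem hk)
  exact map_unipLevi_eq_one c hcompact y

theorem integral_leviEmb_mul_unip [IsUltrametricDist F] (f : GL (Fin n) F → ℂ)
    (g : GL (Fin n) F) (y : LeviUpper F c) :
    ∫ x, f (g * leviEmb c (unipLevi c y) * unip c x) ∂(Measure.pi fun _ => haarF F) =
      ∫ x, f (g * unip (Composition.ones n) (joinUpper c (y, x)))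
        ∂(Measure.pi fun _ => haarF F) := by
  rw [← integral_comp_mulVec (haarScale_leftMulHom_unipLevi c y)
    fun x => f (g * unip (Composition.ones n) (joinUpper c (y, x)))]
  congr! 3 with x
  rw [mul_assoc]
  congr 1
  refine Units.ext ?_
  rw [leviEmb_mul_unip_val, unip_joinUpper_val]
  rfl

theorem IsHecke.integrable_unip {f : GL (Fin n) F → ℂ} (hf : IsHecke f) (g : GL (Fin n) F) :
    Integrable (fun x => f (g * unip c x)) (Measure.pi fun _ => haarF F) :=
  (hf.locConst.continuous.comp
    (continuous_const.mul (continuous_unip c))).integrable_of_hasCompactSupport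
    (hf.compactSupport.comp_isClosedEmbedding
      ((Homeomorph.mulLeft g).isClosedEmbedding.comp (isClosedEmbedding_unip c)))

end LeviMeasure

/-! ### Unramified functions on Levi subgroups -/

section EntryBounded

variable {F : Type*} [NontriviallyNormedField F] {n : ℕ}

/-- The entries of `g` and of `g⁻¹` have norm at most `C`; these sets exhaust `GL_n(F)` by
compact sets. -/
def IsEntryBounded (C : ℝ) (g : GL (Fin n) F) : Prop :=
  ∀ a b, ‖g.val a b‖ ≤ C ∧ ‖g⁻¹.val a b‖ ≤ C

theorem isCompact_setOf_isEntryBounded [ProperSpace F] (C : ℝ) :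
    IsCompact {g : GL (Fin n) F | IsEntryBounded C g} := by
  let B : Set (Matrix (Fin n) (Fin n) F) :=
    Set.univ.pi fun _ => Set.univ.pi fun _ => Metric.closedBall 0 C
  have hB : IsCompact B :=
    isCompact_univ_pi fun _ => isCompact_univ_pi fun _ => isCompact_closedBall 0 C
  convert Units.isClosedEmbedding_embedProduct.isCompact_preimage
    (hB.prod (MulOpposite.opHomeomorph.symm.isCompact_preimage.2 hB)) using 1
  have hmem (A : Matrix (Fin n) (Fin n) F) : A ∈ B ↔ ∀ a b, ‖A a b‖ ≤ C := by
    change (∀ a ∈ Set.univ, ∀ b ∈ Set.univ, A a b ∈ Metric.closedBall 0 C) ↔ _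
    simp only [Set.mem_univ, true_implies, mem_closedBall_zero_iff]
  ext g
  change (∀ a b, _ ∧ _) ↔ g.val ∈ B ∧ g⁻¹.val ∈ B
  simp only [hmem, forall_and]

theorem IsHecke.exists_norm_le {G E : Type*} [TopologicalSpace G] [SeminormedAddCommGroup E]
    {f : G → ℂ} (hf : IsHecke f) {φ : G → E} (hφ : Continuous φ) :
    ∃ C, ∀ g, f g ≠ 0 → ‖φ g‖ ≤ C :=
  let ⟨C, hC⟩ := (hf.compactSupport.isCompact.image hφ).isBounded.exists_norm_le
  ⟨C, fun g hg => hC _ ⟨g, subset_tsupport f hg, rfl⟩⟩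

theorem IsHecke.exists_isEntryBounded {G : Type*} [TopologicalSpace G] {f : G → ℂ}
    (hf : IsHecke f) {φ : G → GL (Fin n) F} (hφ : Continuous φ) :
    ∃ C, ∀ g, f g ≠ 0 → IsEntryBounded C (φ g) := by
  let entries (g : GL (Fin n) F) (p : Fin n × Fin n) : F := g.val p.1 p.2
  have hentries : Continuous entries := continuous_pi fun p => continuous_GL_apply p.1 p.2
  obtain ⟨C, hC⟩ := hf.exists_norm_le (hentries.comp hφ)
  obtain ⟨D, hD⟩ := hf.exists_norm_le (hentries.comp (continuous_inv.comp hφ))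
  exact ⟨max C D, fun g hg a b =>
    ⟨((norm_le_pi_norm (entries (φ g)) (a, b)).trans (hC g hg)).trans (le_max_left C D),
      ((norm_le_pi_norm (entries (φ g)⁻¹) (a, b)).trans (hD g hg)).trans (le_max_right C D)⟩⟩

end EntryBounded

theorem isLocallyConstant_of_mul_right {G X : Type*} [Group G] [TopologicalSpace G]
    [ContinuousMul G] {f : G → X} {U : Subgroup G} (hU : IsOpen (U : Set G))
    (hf : ∀ g, ∀ u ∈ U, f (g * u) = f g) : IsLocallyConstant f := by
  refine (IsLocallyConstant.iff_eventually_eq f).2 fun g => ?_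
  have hmem : ∀ᶠ g' in nhds g, g⁻¹ * g' ∈ U :=
    (continuous_const_mul g⁻¹).continuousAt.eventually_mem (hU.mem_nhds (by simp [one_mem]))
  filter_upwards [hmem] with g' hg'
  simpa using hf g _ hg'

section Levi

variable {F : Type*} [NontriviallyNormedField F] [IsUltrametricDist F] {n : ℕ}

theorem isOpen_maxCompact : IsOpen (maxCompact F n : Set (GL (Fin n) F)) := by
  have hset : (maxCompact F n : Set (GL (Fin n) F)) =
      (⋂ a, ⋂ b, (fun g => g.val a b) ⁻¹' Metric.closedBall 0 1) ∩
        (fun g => g.val.det) ⁻¹' Metric.sphere 0 1 := by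
    ext g
    simp [mem_maxCompact_iff]
  rw [hset]
  refine IsOpen.inter (isOpen_iInter_of_finite fun a => isOpen_iInter_of_finite fun b =>
    (IsUltrametricDist.isOpen_closedBall 0 one_ne_zero).preimage (continuous_GL_apply a b)) ?_
  exact (IsUltrametricDist.isOpen_sphere 0 one_ne_zero).preimage
    Units.continuous_val.matrix_det

variable (c : Composition n)

theorem isOpen_leviMaxCompact : IsOpen (leviMaxCompact F c : Set (Levi F c)) := by
  have hset : (leviMaxCompact F c : Set (Levi F c)) =
      Set.univ.pi fun i => (maxCompact F (c.blocksFun i) : Set _) := by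
    ext m
    simp [mem_leviMaxCompact]
  rw [hset]
  exact isOpen_set_pi Set.finite_univ fun i _ => isOpen_maxCompact

/-- Membership in the unramified Hecke algebra of the Levi subgroup `M(F)`. -/
structure IsUnramifiedLevi (φ : Levi F c → ℂ) : Prop extends IsHecke φ where
  biInvariant : ∀ k₁ ∈ leviMaxCompact F c, ∀ k₂ ∈ leviMaxCompact F c, ∀ m,
    φ (k₁ * m * k₂) = φ m

namespace IsUnramifiedLevi

variable {c} {φ : Levi F c → ℂ}

theorem of_isEntryBounded [ProperSpace F]
    (hφ : ∀ k₁ ∈ leviMaxCompact F c, ∀ k₂ ∈ leviMaxCompact F c, ∀ m, φ (k₁ * m * k₂) = φ m)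
    {C : Fin c.length → ℝ} (hC : ∀ m, φ m ≠ 0 → ∀ i, IsEntryBounded (C i) (m i)) :
    IsUnramifiedLevi c φ where
  locConst := isLocallyConstant_of_mul_right (isOpen_leviMaxCompact c) fun m k hk => by
    simpa using hφ 1 (one_mem _) k hk m
  compactSupport := HasCompactSupport.intro
    (isCompact_univ_pi fun i => isCompact_setOf_isEntryBounded (C i)) fun m hm => by
      contrapose! hm
      exact fun i _ => hC m hm i
  biInvariant := hφ

theorem exists_isEntryBounded (hφ : IsUnramifiedLevi c φ) :
    ∃ C : Fin c.length → ℝ, ∀ m, φ m ≠ 0 → ∀ i, IsEntryBounded (C i) (m i) := by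
  choose C hC using fun i => hφ.toIsHecke.exists_isEntryBounded (continuous_apply i)
  exact ⟨C, fun m hm i => hC i m hm⟩

theorem eq_of_rel (hφ : IsUnramifiedLevi c φ) {m m' : Levi F c}
    (h : ∀ i, MaxCompactRel (m i) (m' i)) : φ m = φ m' := by
  choose k₁ hk₁ k₂ hk₂ heq using h
  rw [← hφ.biInvariant k₁ (mem_leviMaxCompact.2 hk₁) k₂ (mem_leviMaxCompact.2 hk₂) m]
  exact congrArg φ (funext heq)

theorem indicator [ProperSpace F] (hφ : IsUnramifiedLevi c φ) {S : Set (Levi F c)}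
    (hS : ∀ k₁ ∈ leviMaxCompact F c, ∀ k₂ ∈ leviMaxCompact F c, ∀ m, k₁ * m * k₂ ∈ S ↔ m ∈ S) :
    IsUnramifiedLevi c (S.indicator φ) := by
  classical
  obtain ⟨C, hC⟩ := hφ.exists_isEntryBounded
  refine of_isEntryBounded (fun k₁ hk₁ k₂ hk₂ m => ?_) fun m hm =>
    hC m (Set.indicator_apply_ne_zero.1 hm).2
  simp only [Set.indicator_apply, hS k₁ hk₁ k₂ hk₂, hφ.biInvariant k₁ hk₁ k₂ hk₂]

theorem const_mul (hφ : IsUnramifiedLevi c φ) (z : ℂ) :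
    IsUnramifiedLevi c fun m => z * φ m where
  locConst := (IsLocallyConstant.const z).mul hφ.locConst
  compactSupport := hφ.compactSupport.mul_left
  biInvariant k₁ hk₁ k₂ hk₂ m := by rw [hφ.biInvariant k₁ hk₁ k₂ hk₂]

theorem prod [ProperSpace F] {fi : ∀ i : Fin c.length, GL (Fin (c.blocksFun i)) F → ℂ}
    (hfi : ∀ i, IsUnramified (fi i)) : IsUnramifiedLevi c fun m => ∏ i, fi i (m i) := by
  choose C hC using fun i => (hfi i).toIsHecke.exists_isEntryBounded continuous_id
  refine of_isEntryBounded (fun k₁ hk₁ k₂ hk₂ m => Finset.prod_congr rfl fun i _ =>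
    (hfi i).biInvariant _ (mem_leviMaxCompact.1 hk₁ i) _ (mem_leviMaxCompact.1 hk₂ i) _)
    fun m hm i => hC i _ (Finset.prod_ne_zero_iff.1 hm i (Finset.mem_univ i))

end IsUnramifiedLevi

end Levi

section ConstantTerm

variable {F : Type*} [NontriviallyNormedField F] {n : ℕ} (c : Composition n)

theorem isEntryBounded_of_isEntryBounded_mul_unip {C : ℝ} {m : Levi F c} {x : UpperPos c → F}
    (h : IsEntryBounded C (leviEmb c m * unip c x)) (i : Fin c.length) :
    IsEntryBounded C (m i) := by
  intro p q
  obtain ⟨hval, hinv⟩ := h (c.embedding i p) (c.embedding i q)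
  rw [leviEmb_mul_unip_val, Matrix.add_apply, leviEmb_apply_embedding,
    upperMatrix_apply_of_not_lt c _ (by simp), add_zero] at hval
  refine ⟨hval, ?_⟩
  have hentry : (leviEmb c m * unip c x)⁻¹.val (c.embedding i p) (c.embedding i q) =
      (m i)⁻¹.val p q := by
    rw [mul_inv_rev, ← map_inv, Units.val_mul, Matrix.mul_apply,
      Finset.sum_eq_single (c.embedding i p), unip_inv_apply_of_index_eq c x rfl,
      Matrix.one_apply_eq, one_mul, leviEmb_apply_embedding, Pi.inv_apply]
    · intro k _ hk
      by_cases hindex : c.index (c.embedding i p) = c.index k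
      · rw [unip_inv_apply_of_index_eq c x hindex, Matrix.one_apply_ne hk.symm, zero_mul]
      · rw [isBlockDiagonal_leviEmb c _ _ _ (by simpa [eq_comm] using hindex), mul_zero]
    · simp
  rwa [hentry] at hinv

variable [IsUltrametricDist F] [ProperSpace F] [MeasurableSpace F] [BorelSpace F]
  {f : GL (Fin n) F → ℂ}

theorem IsUnramified.constantTerm_mul_mul (hf : IsUnramified f) {k₁ k₂ : Levi F c}
    (hk₁ : k₁ ∈ leviMaxCompact F c) (hk₂ : k₂ ∈ leviMaxCompact F c) (m : Levi F c) :
    constantTerm c f (k₁ * m * k₂) = constantTerm c f m := by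
  have hscale : haarScale ((adHom c).toHomUnits k₂) = 1 := by
    refine haarScale_eq_one_of_integral (norm_adHom_apply_le_one c hk₂) ?_
    rw [← map_inv]
    exact norm_adHom_apply_le_one c (inv_mem hk₂)
  have hf_mul (x : UpperPos c → F) : f (leviEmb c (k₁ * m * k₂) * unip c x) =
      f (leviEmb c m * unip c ((adHom c k₂).mulVec x)) := by
    rw [map_mul, map_mul, mul_assoc _ (leviEmb c k₂), leviEmb_mul_unip, ← mul_assoc,
      mul_assoc (leviEmb c k₁), hf.biInvariant _ (leviEmb_mem_maxCompact c hk₁) _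
        (leviEmb_mem_maxCompact c hk₂)]
  simp_rw [constantTerm, modular_mul, modular_of_mem_leviMaxCompact c hk₁,
    modular_of_mem_leviMaxCompact c hk₂, one_mul, mul_one, hf_mul]
  exact congrArg _ (integral_comp_mulVec hscale fun x => f (leviEmb c m * unip c x))

theorem IsUnramified.constantTerm (hf : IsUnramified f) :
    IsUnramifiedLevi c (GLTrunc.constantTerm c f) := by
  obtain ⟨C, hC⟩ := hf.toIsHecke.exists_isEntryBounded continuous_id
  refine .of_isEntryBounded (C := fun _ => C)
    (fun k₁ hk₁ k₂ hk₂ => hf.constantTerm_mul_mul c hk₁ hk₂) fun m hm => ?_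
  obtain ⟨x, hx⟩ : ∃ x, f (leviEmb c m * unip c x) ≠ 0 := by
    contrapose! hm
    simp [GLTrunc.constantTerm, hm]
  exact isEntryBounded_of_isEntryBounded_mul_unip c (hC _ hx)

end ConstantTerm

/-! ### The Satake transform on Levi subgroups -/

section LeviSatake

variable {F : Type*} [NontriviallyNormedField F] [ProperSpace F] [MeasurableSpace F]
  [BorelSpace F] {n : ℕ} (c : Composition n)

theorem satake_eq (f : GL (Fin n) F → ℂ) (t : Fin n → Fˣ) : satake f t =
    (√(modular (Composition.ones n) (torusToLevi (Composition.ones n) t)) : ℂ) *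
      ∫ x, f (diagGL t * unip (Composition.ones n) x) ∂(Measure.pi fun _ => haarF F) := by
  rw [satake, constantTerm, leviEmb_torusToLevi]

/-- The Satake transform on the Levi subgroup `M(F)`: the constant term along the upper triangular
Borel subgroup of `M`, as a function on the diagonal torus. -/
noncomputable def leviSatake (φ : Levi F c → ℂ) (t : Fin n → Fˣ) : ℂ :=
  (∏ i, (√(modular (Composition.ones (c.blocksFun i))
    (torusToLevi (Composition.ones (c.blocksFun i)) (blockCoords c t i))) : ℂ)) *
    ∫ y, φ (torusToLevi c t * unipLevi c y) ∂(leviUpperMeasure F c)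

variable {c} in
theorem IsHecke.integrable_unipLevi {φ : Levi F c → ℂ} (hφ : IsHecke φ) (m : Levi F c) :
    Integrable (fun y => φ (m * unipLevi c y)) (leviUpperMeasure F c) :=
  (hφ.locConst.continuous.comp (continuous_const.mul
    (isClosedEmbedding_unipLevi c).continuous)).integrable_of_hasCompactSupport
    (hφ.compactSupport.comp_isClosedEmbedding
      ((Homeomorph.mulLeft m).isClosedEmbedding.comp (isClosedEmbedding_unipLevi c)))

variable {c} in
theorem leviSatake_sub {φ ψ : Levi F c → ℂ} (hφ : IsHecke φ) (hψ : IsHecke ψ) (t : Fin n → Fˣ) :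
    leviSatake c (φ - ψ) t = leviSatake c φ t - leviSatake c ψ t := by
  simp_rw [leviSatake, Pi.sub_apply]
  rw [integral_sub (hφ.integrable_unipLevi _) (hψ.integrable_unipLevi _), mul_sub]

theorem leviSatake_const_mul (z : ℂ) (φ : Levi F c → ℂ) (t : Fin n → Fˣ) :
    leviSatake c (fun m => z * φ m) t = z * leviSatake c φ t := by
  rw [leviSatake, integral_const_mul, leviSatake, mul_left_comm]

theorem leviSatake_prod (fi : ∀ i : Fin c.length, GL (Fin (c.blocksFun i)) F → ℂ)
    (t : Fin n → Fˣ) :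
    leviSatake c (fun m => ∏ i, fi i (m i)) t = ∏ i, satake (fi i) (blockCoords c t i) := by
  simp_rw [satake_eq, Finset.prod_mul_distrib]
  exact congrArg _ (integral_fintype_prod_eq_prod (𝕜 := ℂ) fun i y =>
    fi i (torusToLevi c t i * unip (Composition.ones (c.blocksFun i)) y))

theorem leviSatake_constantTerm [IsUltrametricDist F] {f : GL (Fin n) F → ℂ} (hf : IsHecke f)
    (t : Fin n → Fˣ) : leviSatake c (constantTerm c f) t = satake f t := by
  have hmp := measurePreserving_joinUpper (F := F) c
  have hint := hf.integrable_unip (Composition.ones n) (diagGL t)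
  have hconst (y : LeviUpper F c) : constantTerm c f (torusToLevi c t * unipLevi c y) =
      (√(modular c (torusToLevi c t)) : ℂ) *
        ∫ x, f (diagGL t * unip (Composition.ones n) (joinUpper c (y, x)))
          ∂(Measure.pi fun _ => haarF F) := by
    rw [constantTerm, modular_mul, modular_unipLevi, mul_one, map_mul, leviEmb_torusToLevi,
      integral_leviEmb_mul_unip]
  simp_rw [leviSatake, hconst]
  rw [integral_const_mul, ← integral_prod
      (fun z => f (diagGL t * unip (Composition.ones n) (joinUpper c z)))
      (hmp.integrable_comp_of_integrable hint),
    hmp.integral_comp (joinUpper (F := F) c).toHomeomorph.measurableEmbedding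
      (fun z => f (diagGL t * unip (Composition.ones n) z)),
    satake_eq, modular_ones_torusToLevi c t,
    Real.sqrt_mul (Finset.prod_nonneg fun i _ => (modular_pos _ _).le),
    Real.sqrt_prod _ fun i _ => (modular_pos _ _).le, ← mul_assoc]
  push_cast
  rfl

end LeviSatake

/-! ### Injectivity of the Satake transform -/

section Injectivity

variable {F : Type*} [NontriviallyNormedField F] [IsUltrametricDist F]

theorem IsNormalizedUniformizer.finite_norms {ϖ : F} (hϖ : IsNormalizedUniformizer ϖ) (C : ℝ) :
    {r | ∃ x : Fˣ, ‖(x : F)‖ = r ∧ ‖(x : F)‖ ≤ C ∧ ‖(↑x⁻¹ : F)‖ ≤ C}.Finite := by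
  obtain ⟨N, hN⟩ := pow_unbounded_of_one_lt C ((one_lt_inv₀ hϖ.norm_pos).2 hϖ.norm_lt_one)
  refine ((Set.finite_Icc (-N : ℤ) N).image fun k => ‖ϖ‖ ^ k).subset ?_
  rintro _ ⟨x, rfl, hx, hx_inv⟩
  obtain ⟨k, hk⟩ := hϖ.exists_norm_eq_zpow x.ne_zero
  rw [Units.val_inv_eq_inv_val, norm_inv] at hx_inv
  rw [hk] at hx hx_inv ⊢
  rw [inv_pow] at hN
  have hbound (l : ℤ) (hl : ‖ϖ‖ ^ l ≤ C) : -N ≤ l := by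
    have hlt := hl.trans_lt hN
    rw [← zpow_natCast, ← zpow_neg,
      zpow_lt_zpow_iff_right_of_lt_one₀ hϖ.norm_pos hϖ.norm_lt_one] at hlt
    exact hlt.le
  exact ⟨k, ⟨hbound k hx, by
    have := hbound (-k) (by rwa [zpow_neg])
    omega⟩, rfl⟩

variable {n : ℕ} {c : Composition n} {φ ψ : Levi F c → ℂ} {ϖ : F}

/-- The norms of the entries of a diagonal matrix, ordered lexicographically within each block. -/
def blockNorms (c : Composition n) (t : Fin n → Fˣ) (i : Fin c.length) :
    Lex (Fin (c.blocksFun i) → ℝ) :=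
  toLex fun p => ‖(blockCoords c t i p : F)‖

theorem IsUnramifiedLevi.sub (hφ : IsUnramifiedLevi c φ) (hψ : IsUnramifiedLevi c ψ) :
    IsUnramifiedLevi c (φ - ψ) where
  locConst := hφ.locConst.sub hψ.locConst
  compactSupport := hφ.compactSupport.sub hψ.compactSupport
  biInvariant k₁ hk₁ k₂ hk₂ m := by
    rw [Pi.sub_apply, Pi.sub_apply, hφ.biInvariant k₁ hk₁ k₂ hk₂, hψ.biInvariant k₁ hk₁ k₂ hk₂]

theorem IsUnramifiedLevi.exists_maximal (hφ : IsUnramifiedLevi c φ)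
    (hϖ : IsNormalizedUniformizer ϖ) (hne : φ ≠ 0) :
    ∃ t, MaximalFor (fun t => φ (torusToLevi c t) ≠ 0) (blockNorms c) t := by
  refine Set.Finite.exists_maximalFor' _ {t | φ (torusToLevi c t) ≠ 0} ?_ ?_
  · obtain ⟨C, hC⟩ := hφ.exists_isEntryBounded
    refine (Set.Finite.pi' fun i => Set.Finite.pi' fun _ => hϖ.finite_norms (C i)).subset ?_
    rintro _ ⟨t, ht, rfl⟩ i p
    obtain ⟨hval, hinv⟩ := hC _ ht i p p
    rw [torusToLevi_apply, diagGL_val, Matrix.diagonal_apply_eq] at hval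
    rw [torusToLevi_apply, diagGL_inv, diagGL_val, Matrix.diagonal_apply_eq] at hinv
    exact ⟨blockCoords c t i p, rfl, hval, hinv⟩
  · obtain ⟨m, hm⟩ := Function.ne_iff.1 hne
    choose t ht using fun i => exists_isCartanForm (m i)
    obtain ⟨t, rfl⟩ := exists_blockCoords_eq c t
    exact ⟨t, (hφ.eq_of_rel fun i => (ht i).rel).symm.trans_ne hm⟩

/-- Otherwise the norms of the Cartan form of `t u`, where `u` has the coordinates `y`, would be
strictly larger than those of `t`. -/
theorem IsUnramifiedLevi.norm_le_one_of_maximal (hφ : IsUnramifiedLevi c φ) {t : Fin n → Fˣ}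
    (ht : MaximalFor (fun t => φ (torusToLevi c t) ≠ 0) (blockNorms c) t) {y : LeviUpper F c}
    (hy : φ (torusToLevi c t * unipLevi c y) ≠ 0) : ‖y‖ ≤ 1 := by
  let g (i : Fin c.length) : GL (Fin (c.blocksFun i)) F :=
    diagGL (blockCoords c t i) * unip (Composition.ones (c.blocksFun i)) (y i)
  have hdiag (i p) : (g i).val p p = blockCoords c t i p := by
    rw [Units.val_mul, diagGL_val, Matrix.diagonal_mul, unip_apply_self, mul_one]
  have hupper (i) (p q) (hqp : q < p) : (g i).val p q = 0 := by
    rw [Units.val_mul, diagGL_val, Matrix.diagonal_mul, unip_ones_apply_of_gt _ hqp, mul_zero]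
  choose s hs hle hbound using fun i => exists_isCartanForm_of_upper (g i) (hupper i)
  obtain ⟨s, rfl⟩ := exists_blockCoords_eq c s
  have hφs : φ (torusToLevi c s) ≠ 0 :=
    (hφ.eq_of_rel (m' := torusToLevi c s) fun i => (hs i).rel).symm.trans_ne hy
  have hle' : blockNorms c t ≤ blockNorms c s := fun i => by
    simp only [hdiag] at hle
    exact hle i
  have heq : blockNorms c t = blockNorms c s := hle'.antisymm (ht.2 hφs hle')
  refine (pi_norm_le_iff_of_nonneg zero_le_one).2 fun i =>
    (pi_norm_le_iff_of_nonneg zero_le_one).2 fun p => ?_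
  have hentry := hbound i (fun q => by rw [hdiag]; exact congrFun (congrFun heq i) q) p.1.1 p.1.2
  rw [hdiag, Units.val_mul, diagGL_val, Matrix.diagonal_mul, unip_apply_of_lt _ _ p.2,
    norm_mul] at hentry
  exact (mul_le_iff_le_one_right (norm_pos_iff.2 (Units.ne_zero _))).1 hentry

variable [ProperSpace F] [MeasurableSpace F] [BorelSpace F]

theorem IsUnramifiedLevi.leviSatake_ne_zero_of_maximal (hφ : IsUnramifiedLevi c φ)
    {t : Fin n → Fˣ}
    (ht : MaximalFor (fun t => φ (torusToLevi c t) ≠ 0) (blockNorms c) t) :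
    leviSatake c φ t ≠ 0 := by
  have hindicator : (fun y => φ (torusToLevi c t * unipLevi c y)) =
      (Metric.closedBall 0 1).indicator fun _ => φ (torusToLevi c t) := by
    funext y
    by_cases hy : ‖y‖ ≤ 1
    · rw [Set.indicator_of_mem (mem_closedBall_zero_iff.2 hy)]
      have hmem : unipLevi c y ∈ leviMaxCompact F c := mem_leviMaxCompact.2 fun i =>
        unip_mem_maxCompact fun p => (norm_le_pi_norm (y i) p).trans
          ((norm_le_pi_norm y i).trans hy)
      simpa only [one_mul] using hφ.biInvariant 1 (one_mem _) _ hmem (torusToLevi c t)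
    · rw [Set.indicator_of_notMem (by simpa using hy)]
      exact of_not_not (mt (hφ.norm_le_one_of_maximal ht) hy)
  rw [leviSatake, hindicator, integral_indicator_const _ Metric.isClosed_closedBall.measurableSet,
    measureReal_def, leviUpperMeasure_closedBall, ENNReal.toReal_one, one_smul]
  refine mul_ne_zero (Finset.prod_ne_zero_iff.2 fun i _ => ?_) ht.1
  exact Complex.ofReal_ne_zero.2 (Real.sqrt_pos.2 (modular_pos _ _)).ne'

theorem IsUnramifiedLevi.eq_zero_of_leviSatake_eq_zero (hφ : IsUnramifiedLevi c φ)
    (hϖ : IsNormalizedUniformizer ϖ) (h : leviSatake c φ = 0) : φ = 0 := by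
  by_contra hne
  obtain ⟨t, ht⟩ := hφ.exists_maximal hϖ hne
  exact hφ.leviSatake_ne_zero_of_maximal ht (congrFun h t)

theorem IsUnramifiedLevi.eq_of_leviSatake_eq (hφ : IsUnramifiedLevi c φ)
    (hψ : IsUnramifiedLevi c ψ) (hϖ : IsNormalizedUniformizer ϖ)
    (h : leviSatake c φ = leviSatake c ψ) : φ = ψ := by
  refine sub_eq_zero.1 ((hφ.sub hψ).eq_zero_of_leviSatake_eq_zero hϖ (funext fun t => ?_))
  rw [leviSatake_sub hφ.toIsHecke hψ.toIsHecke, h, sub_self, Pi.zero_apply]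

end Injectivity

/-! ### Constant terms of Kottwitz functions -/

section LaurentEvaluation

variable {F : Type*} [NontriviallyNormedField F] {n : ℕ} (ϖ : F)

theorem Laurent.toFun_add (p p' : Laurent n) (t : Fin n → Fˣ) :
    (p + p').toFun ϖ t = p.toFun ϖ t + p'.toFun ϖ t := by
  classical
  rw [Laurent.toFun, AddMonoidAlgebra.coeff_add, Finsupp.sum_add_index' (by simp)
    fun μ a b => by split_ifs <;> simp]
  rfl

theorem Laurent.toFun_sum {ι : Type*} (s : Finset ι) (p : ι → Laurent n) (t : Fin n → Fˣ) :
    (∑ i ∈ s, p i).toFun ϖ t = ∑ i ∈ s, (p i).toFun ϖ t :=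
  map_sum (AddMonoidHom.mk' (fun p : Laurent n => p.toFun ϖ t)
    fun p p' => Laurent.toFun_add ϖ p p' t) p s

theorem Laurent.toFun_smul (z : ℂ) (p : Laurent n) (t : Fin n → Fˣ) :
    (z • p).toFun ϖ t = z * p.toFun ϖ t := by
  rw [Laurent.toFun, AddMonoidAlgebra.coeff_smul, Finsupp.sum_smul_index (by simp),
    Laurent.toFun, Finsupp.mul_sum]
  simp only [mul_ite, mul_zero]

open Classical in
theorem Laurent.toFun_single (μ : Fin n → ℤ) (t : Fin n → Fˣ) :
    Laurent.toFun ϖ (AddMonoidAlgebra.single μ 1 : Laurent n) t =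
      if ∀ k, ‖(t k : F)‖ = ‖ϖ‖ ^ μ k then 1 else 0 := by
  rw [Laurent.toFun, AddMonoidAlgebra.coeff_single, Finsupp.sum_single_index (by simp)]

theorem prod_X_pow (I : Finset (Fin n)) (α : ℕ) : (∏ i ∈ I, X i) ^ α =
    (AddMonoidAlgebra.single (fun k => if k ∈ I then (α : ℤ) else 0) 1 : Laurent n) := by
  have hprod : ∏ i ∈ I, X i =
      (AddMonoidAlgebra.single (∑ i ∈ I, Pi.single i (1 : ℤ)) 1 : Laurent n) := by
    induction I using Finset.induction_on with
    | empty => rfl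
    | insert a s ha ih =>
      rw [Finset.prod_insert ha, ih, Finset.sum_insert ha, X, AddMonoidAlgebra.single_mul_single,
        one_mul]
  rw [hprod, AddMonoidAlgebra.single_pow, one_pow]
  congr 1
  funext k
  simp [Pi.single_apply]

end LaurentEvaluation

section Minuscule

variable {F : Type*} [NontriviallyNormedField F] {n : ℕ} {ϖ : F} {α : ℕ} {t : Fin n → Fˣ}

/-- The indices at which the diagonal matrix `t` has valuation `α`. -/
noncomputable def slopeIndices (ϖ : F) (α : ℕ) (t : Fin n → Fˣ) : Finset (Fin n) :=
  Finset.univ.filter fun k => ‖(t k : F)‖ = ‖ϖ‖ ^ α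

/-- All valuations of the entries of the diagonal matrix `t` are `0` or `α`. -/
def IsMinuscule (ϖ : F) (α : ℕ) (t : Fin n → Fˣ) : Prop :=
  ∀ k, ‖(t k : F)‖ = 1 ∨ ‖(t k : F)‖ = ‖ϖ‖ ^ α

theorem IsMinuscule.prod_norm (ht : IsMinuscule ϖ α t) :
    ∏ k, ‖(t k : F)‖ = ‖ϖ‖ ^ (α * (slopeIndices ϖ α t).card) := by
  rw [pow_mul, ← Finset.prod_const, slopeIndices, Finset.prod_filter]
  refine Finset.prod_congr rfl fun k _ => ?_
  split_ifs with h
  · exact h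
  · exact (ht k).resolve_right h

theorem forall_isMinuscule_blockCoords_iff (c : Composition n) :
    (∀ i, IsMinuscule ϖ α (blockCoords c t i)) ↔ IsMinuscule ϖ α t := by
  refine ⟨fun h a => ?_, fun h i p => h _⟩
  obtain ⟨i, p, rfl⟩ := exists_eq_embedding c a
  exact h i p

theorem sum_card_slopeIndices (c : Composition n) (ϖ : F) (α : ℕ) (t : Fin n → Fˣ) :
    ∑ i, (slopeIndices ϖ α (blockCoords c t i)).card = (slopeIndices ϖ α t).card := by
  simp_rw [slopeIndices, Finset.card_filter]
  rw [← c.blocksFinEquiv.sum_comp, Fintype.sum_sigma]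
  rfl

variable [IsUltrametricDist F]

theorem IsMinuscule.prod_norm_eq_iff (ht : IsMinuscule ϖ α t) (hϖ : IsNormalizedUniformizer ϖ)
    (hα : 0 < α) {s : ℕ} :
    ∏ k, ‖(t k : F)‖ = ‖ϖ‖ ^ (α * s) ↔ (slopeIndices ϖ α t).card = s := by
  rw [ht.prod_norm, (pow_right_injective₀ hϖ.norm_pos hϖ.norm_lt_one.ne).eq_iff,
    Nat.mul_right_inj hα.ne']

theorem forall_norm_eq_iff_isMinuscule (hϖ : IsNormalizedUniformizer ϖ) (hα : 0 < α)
    (I : Finset (Fin n)) :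
    (∀ k, ‖(t k : F)‖ = ‖ϖ‖ ^ (if k ∈ I then (α : ℤ) else 0)) ↔
      IsMinuscule ϖ α t ∧ slopeIndices ϖ α t = I := by
  have hne : (1 : ℝ) ≠ ‖ϖ‖ ^ α := (pow_lt_one₀ hϖ.norm_pos.le hϖ.norm_lt_one hα.ne').ne'
  have hpow (k : Fin n) : ‖ϖ‖ ^ (if k ∈ I then (α : ℤ) else 0) =
      if k ∈ I then ‖ϖ‖ ^ α else 1 := by
    split_ifs <;> simp
  simp only [IsMinuscule, slopeIndices, Finset.ext_iff, Finset.mem_filter_univ, ← forall_and, hpow]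
  refine forall_congr' fun k => ?_
  split_ifs with hk <;> simp only [hk, iff_true, iff_false]
  · exact ⟨fun h => ⟨.inr h, h⟩, And.right⟩
  · exact ⟨fun h => ⟨.inl h, h ▸ hne⟩, fun h => h.1.resolve_right h.2⟩

/-- The coefficient `q^{α s (n - s) / 2}`. -/
noncomputable def kottwitzCoeff (F : Type*) [NontriviallyNormedField F] [IsUltrametricDist F]
    (n α s : ℕ) : ℂ :=
  (((resCard F : ℝ) ^ ((α : ℝ) * s * ((n : ℝ) - s) / 2) : ℝ) : ℂ)

open Classical in
theorem toFun_kottwitzPoly (hϖ : IsNormalizedUniformizer ϖ) (hα : 0 < α) (s : ℕ) :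
    (kottwitzPoly F n α s).toFun ϖ t =
      if IsMinuscule ϖ α t ∧ (slopeIndices ϖ α t).card = s then kottwitzCoeff F n α s else 0 := by
  rw [kottwitzPoly, Laurent.toFun_smul, Laurent.toFun_sum]
  simp_rw [prod_X_pow, Laurent.toFun_single, forall_norm_eq_iff_isMinuscule hϖ hα]
  by_cases ht : IsMinuscule ϖ α t
  · simp only [ht, true_and, Finset.sum_ite_eq, Finset.mem_powersetCard, Finset.subset_univ,
      mul_ite, mul_one, mul_zero]
    rfl
  · simp [ht]

theorem kottwitzCoeff_eq_prod (hq : 0 < resCard F) (c : Composition n) (α s : ℕ)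
    (si : Fin c.length → ℕ) : kottwitzCoeff F n α s =
      (((resCard F : ℝ) ^ ((α : ℝ) * constC c s si) : ℝ) : ℂ) *
        ∏ i, kottwitzCoeff F (c.blocksFun i) α (si i) := by
  have hq' : (0 : ℝ) < resCard F := by exact_mod_cast hq
  simp_rw [kottwitzCoeff]
  rw [← Complex.ofReal_prod, ← Complex.ofReal_mul, ← Real.rpow_sum_of_pos hq',
    ← Real.rpow_add hq', constC, mul_sub (α : ℝ), Finset.mul_sum]
  have hexp (i : Fin c.length) : (α : ℝ) * si i * ((c.blocksFun i : ℝ) - si i) / 2 =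
      α * ((si i : ℝ) * ((c.blocksFun i : ℝ) - si i) / 2) := by ring
  simp_rw [hexp]
  congr 2
  ring

end Minuscule

section DetNorms

variable {F : Type*} [NontriviallyNormedField F] {n : ℕ} (c : Composition n)

/-- The norms of the determinants of the blocks, as a homomorphism on `M(F)`. -/
noncomputable def detNorms (F : Type*) [NontriviallyNormedField F] {n : ℕ} (c : Composition n) :
    Levi F c →* (Fin c.length → ℝ) where
  toFun m i := ‖(m i).val.det‖
  map_one' := by ext; simp
  map_mul' m m' := by ext; simp

theorem detNorms_apply (m : Levi F c) (i : Fin c.length) : detNorms F c m i = ‖(m i).val.det‖ :=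
  rfl

theorem detNorms_torusToLevi (t : Fin n → Fˣ) (i : Fin c.length) :
    detNorms F c (torusToLevi c t) i = ∏ p, ‖(blockCoords c t i p : F)‖ := by
  rw [detNorms_apply, torusToLevi_apply, diagGL_val, Matrix.det_diagonal, norm_prod]

theorem prod_detNorms_torusToLevi (t : Fin n → Fˣ) :
    ∏ i, detNorms F c (torusToLevi c t) i = ∏ a, ‖(t a : F)‖ := by
  simp_rw [detNorms_torusToLevi]
  exact Composition.prod_prod_apply_embedding (fun a => ‖(t a : F)‖) c

theorem detNorms_unipLevi (y : LeviUpper F c) : detNorms F c (unipLevi c y) = 1 := by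
  ext i
  rw [detNorms_apply, unipLevi, show (unip _ (y i)).val.det = 1 from det_unipMatrix _ _, norm_one,
    Pi.one_apply]

open Classical in
theorem leviSatake_indicator_detNorms [ProperSpace F] [MeasurableSpace F] [BorelSpace F]
    (D : Set (Fin c.length → ℝ)) (φ : Levi F c → ℂ) (t : Fin n → Fˣ) :
    leviSatake c ((detNorms F c ⁻¹' D).indicator φ) t =
      if detNorms F c (torusToLevi c t) ∈ D then leviSatake c φ t else 0 := by
  simp_rw [leviSatake, Set.indicator_apply, Set.mem_preimage, map_mul, detNorms_unipLevi, mul_one]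
  split_ifs
  · rfl
  · rw [integral_zero, mul_zero]

variable {c} in
theorem IsUnramifiedLevi.indicator_detNorms [IsUltrametricDist F] [ProperSpace F]
    {φ : Levi F c → ℂ} (hφ : IsUnramifiedLevi c φ) (D : Set (Fin c.length → ℝ)) :
    IsUnramifiedLevi c ((detNorms F c ⁻¹' D).indicator φ) := by
  have hcompact (k : Levi F c) (hk : k ∈ leviMaxCompact F c) : detNorms F c k = 1 :=
    funext fun i => (mem_maxCompact_iff.1 (mem_leviMaxCompact.1 hk i)).2
  refine hφ.indicator fun k₁ hk₁ k₂ hk₂ m => ?_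
  rw [Set.mem_preimage, map_mul, map_mul, hcompact k₁ hk₁, hcompact k₂ hk₂, one_mul, mul_one,
    Set.mem_preimage]

end DetNorms

namespace IsKottwitzFunction

variable {F : Type*} [NontriviallyNormedField F] [IsUltrametricDist F] [ProperSpace F]
  [MeasurableSpace F] [BorelSpace F] {n : ℕ} {ϖ : F} {α s : ℕ} {f : GL (Fin n) F → ℂ}

open Classical in
theorem satake_eq_ite (hf : IsKottwitzFunction ϖ n α s f) (hϖ : IsNormalizedUniformizer ϖ)
    (hα : 0 < α) (t : Fin n → Fˣ) : satake f t =
      if IsMinuscule ϖ α t ∧ (slopeIndices ϖ α t).card = s then kottwitzCoeff F n α s else 0 := by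
  rw [hf.satake_eq, toFun_kottwitzPoly hϖ hα]

theorem prod_norm_det_of_constantTerm_ne_zero (hf : IsKottwitzFunction ϖ n α s f)
    (hϖ : IsNormalizedUniformizer ϖ) (hα : 0 < α) (c : Composition n) {m : Levi F c}
    (hm : constantTerm c f m ≠ 0) : ∏ i, ‖(m i).val.det‖ = ‖ϖ‖ ^ (α * s) := by
  classical
  let D : Set (Fin c.length → ℝ) := {v | ∏ i, v i ≠ ‖ϖ‖ ^ (α * s)}
  have hzero : (detNorms F c ⁻¹' D).indicator (constantTerm c f) = 0 := by
    refine ((hf.unramified.constantTerm c).indicator_detNorms D).eq_zero_of_leviSatake_eq_zero hϖ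
      (funext fun t => ?_)
    rw [leviSatake_indicator_detNorms, leviSatake_constantTerm c hf.unramified.toIsHecke,
      hf.satake_eq_ite hϖ hα, Pi.zero_apply, ← ite_and, if_neg]
    rintro ⟨hD, ht, hcard⟩
    rw [Set.mem_ofPred_eq, prod_detNorms_torusToLevi] at hD
    exact hD ((ht.prod_norm_eq_iff hϖ hα).2 hcard)
  by_contra hne
  exact hm ((Set.indicator_of_mem (show m ∈ detNorms F c ⁻¹' D from hne) _).symm.trans
    (congrFun hzero m))

theorem indicator_constantTerm_eq (hf : IsKottwitzFunction ϖ n α s f)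
    (hϖ : IsNormalizedUniformizer ϖ) (hα : 0 < α) (c : Composition n)
    {si : Fin c.length → ℕ} (hsi : ∑ i, si i = s)
    {fi : ∀ i : Fin c.length, GL (Fin (c.blocksFun i)) F → ℂ}
    (hfi : ∀ i, IsKottwitzFunction ϖ (c.blocksFun i) α (si i) (fi i)) :
    (detNorms F c ⁻¹' {fun i => ‖ϖ‖ ^ (α * si i)}).indicator (constantTerm c f) =
      fun m => (((resCard F : ℝ) ^ ((α : ℝ) * constC c s si) : ℝ) : ℂ) * ∏ i, fi i (m i) := by
  classical
  refine ((hf.unramified.constantTerm c).indicator_detNorms _).eq_of_leviSatake_eq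
    ((IsUnramifiedLevi.prod fun i => (hfi i).unramified).const_mul _) hϖ (funext fun t => ?_)
  rw [leviSatake_indicator_detNorms, leviSatake_constantTerm c hf.unramified.toIsHecke,
    leviSatake_const_mul, leviSatake_prod, hf.satake_eq_ite hϖ hα]
  simp_rw [fun i => (hfi i).satake_eq_ite hϖ hα, Set.mem_singleton_iff, funext_iff,
    detNorms_torusToLevi]
  rw [← ite_and, Finset.prod_ite_zero, mul_ite, mul_zero,
    ← kottwitzCoeff_eq_prod (zero_lt_one.trans hϖ.one_lt_resCard)]
  congr! 1
  simp only [Finset.mem_univ, true_implies, forall_and, forall_isMinuscule_blockCoords_iff c]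
  constructor
  · rintro ⟨hnorm, ht, -⟩
    exact ⟨ht, fun i => (((forall_isMinuscule_blockCoords_iff c).2 ht i).prod_norm_eq_iff hϖ
      hα).1 (hnorm i)⟩
  · rintro ⟨ht, hcard⟩
    refine ⟨fun i => (((forall_isMinuscule_blockCoords_iff c).2 ht i).prod_norm_eq_iff hϖ
      hα).2 (hcard i), ht, ?_⟩
    rw [← sum_card_slopeIndices c, ← hsi]
    exact Finset.sum_congr rfl fun i _ => hcard i

end IsKottwitzFunction

/-! ### Eigenvalues and compact elements -/

theorem charpoly_blockDiagonal' {R ι : Type*} [CommRing R] [Fintype ι] [LinearOrder ι]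
    {κ : ι → Type*} [∀ i, Fintype (κ i)] [∀ i, DecidableEq (κ i)] [∀ i, Nonempty (κ i)]
    (A : ∀ i, Matrix (κ i) (κ i) R) :
    (Matrix.blockDiagonal' A).charpoly = ∏ i, (A i).charpoly := by
  have himage : Finset.univ.image (Sigma.fst : (Σ i, κ i) → ι) = Finset.univ :=
    Finset.image_univ_of_surjective fun i => ⟨⟨i, Classical.arbitrary _⟩, rfl⟩
  rw [(Matrix.blockTriangular_blockDiagonal' A).charpoly, himage]
  refine Finset.prod_congr rfl fun i _ => ?_
  rw [← Matrix.charpoly_reindex (Equiv.sigmaSubtype i).symm]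
  refine congrArg Matrix.charpoly (Matrix.ext fun x y => ?_)
  obtain ⟨p, rfl⟩ := (Equiv.sigmaSubtype i).symm.surjective x
  obtain ⟨r, rfl⟩ := (Equiv.sigmaSubtype i).symm.surjective y
  simp [Matrix.toSquareBlock_def, Equiv.sigmaSubtype, Matrix.blockDiagonal'_apply_eq]

section Eigenvalues

variable {F : Type*} [NontriviallyNormedField F] {n : ℕ}

theorem charpoly_leviEmb (c : Composition n) (m : Levi F c) :
    (leviEmb c m).val.charpoly = ∏ i, (m i).val.charpoly := by
  have (i : Fin c.length) : Nonempty (Fin (c.blocksFun i)) := ⟨⟨0, c.one_le_blocksFun i⟩⟩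
  have hreindex : (leviEmb c m).val = Matrix.reindex c.blocksFinEquiv c.blocksFinEquiv
      (Matrix.blockDiagonal' fun i => (m i).val) := rfl
  rw [hreindex, Matrix.charpoly_reindex, charpoly_blockDiagonal']

theorem eigenvalues_leviEmb (c : Composition n) (m : Levi F c) :
    eigenvalues (leviEmb c m) = ∑ i, eigenvalues (m i) := by
  rw [eigenvalues, charpoly_leviEmb, Polynomial.aroots_def, Polynomial.map_prod,
    Polynomial.roots_prod]
  · rfl
  · exact Finset.prod_ne_zero_iff.2 fun i _ => ((Matrix.charpoly_monic _).map _).ne_zero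

theorem card_eigenvalues (g : GL (Fin n) F) : Multiset.card (eigenvalues g) = n := by
  rw [eigenvalues, Polynomial.aroots_def,
    ← (IsAlgClosed.splits (g.val.charpoly.map _)).natDegree_eq_card_roots,
    Polynomial.natDegree_map, Matrix.charpoly_natDegree_eq_dim, Fintype.card_fin]

theorem prod_eigenvalues (g : GL (Fin n) F) :
    (eigenvalues g).prod = algebraMap F (AlgebraicClosure F) g.val.det := by
  rw [RingHom.map_det, Matrix.det_eq_prod_roots_charpoly, RingHom.mapMatrix_apply,
    Matrix.charpoly_map]
  rfl

theorem det_ne_zero (g : GL (Fin n) F) : g.val.det ≠ 0 :=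
  ((Matrix.isUnit_iff_isUnit_det _).1 g.isUnit).ne_zero

theorem continuous_charpoly_coeff (k : ℕ) :
    Continuous fun g : GL (Fin n) F => g.val.charpoly.coeff k := by
  have heval : (fun g : GL (Fin n) F => g.val.charpoly.coeff k) = fun g =>
      MvPolynomial.eval (fun p : Fin n × Fin n => g.val p.1 p.2)
        ((Matrix.charpoly.univ F (Fin n)).coeff k) :=
    funext fun g => (Matrix.charpoly.univ_coeff_eval₂Hom (Fin n) (RingHom.id F)
      (fun p : Fin n × Fin n => g.val p.1 p.2) k).symm
  rw [heval]
  exact (MvPolynomial.continuous_eval _).comp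
    (continuous_pi fun p => continuous_GL_apply p.1 p.2)

end Eigenvalues

theorem spectralValue_le_iff {R : Type*} [SeminormedRing R] {p : Polynomial R} {ρ : ℝ}
    (hρ : 0 ≤ ρ) :
    spectralValue p ≤ ρ ↔ ∀ k < p.natDegree, ‖p.coeff k‖ ≤ ρ ^ (p.natDegree - k) := by
  have hterm {k : ℕ} (hk : k < p.natDegree) :
      spectralValueTerms p k ≤ ρ ↔ ‖p.coeff k‖ ≤ ρ ^ (p.natDegree - k) := by
    have hpos : (0 : ℝ) < p.natDegree - k := sub_pos.2 (by exact_mod_cast hk)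
    rw [spectralValueTerms_of_lt_natDegree _ hk, one_div,
      Real.rpow_inv_le_iff_of_pos (norm_nonneg _) hρ hpos, ← Nat.cast_sub hk.le, Real.rpow_natCast]
  rw [spectralValue, ciSup_le_iff (spectralValueTerms_bddAbove p)]
  refine ⟨fun h k hk => (hterm hk).1 (h k), fun h k => ?_⟩
  rcases lt_or_ge k p.natDegree with hk | hk
  · exact (hterm hk).2 (h k hk)
  · rwa [spectralValueTerms_of_natDegree_le _ hk]

theorem eq_of_prod_map_eq_pow {ι : Type*} {s : Multiset ι} {φ : ι → ℝ} {ρ : ℝ}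
    (hφ : ∀ x ∈ s, 0 < φ x) (hle : ∀ x ∈ s, φ x ≤ ρ)
    (hprod : (s.map φ).prod = ρ ^ Multiset.card s) {x : ι} (hx : x ∈ s) : φ x = ρ := by
  have hρ : 0 < ρ := (hφ x hx).trans_le (hle x hx)
  obtain ⟨s, rfl⟩ := Multiset.exists_cons_of_mem hx
  rw [Multiset.map_cons, Multiset.prod_cons, Multiset.card_cons, pow_succ'] at hprod
  have hrest : (s.map φ).prod ≤ ρ ^ Multiset.card s := by
    simpa using Multiset.prod_map_le_prod_map₀ φ (fun _ => ρ)
      (fun y hy => (hφ y (Multiset.mem_cons_of_mem hy)).le)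
      (fun y hy => hle y (Multiset.mem_cons_of_mem hy))
  refine (hle x hx).antisymm (le_of_mul_le_mul_right ?_ (pow_pos hρ (Multiset.card s)))
  exact hprod.symm.le.trans (mul_le_mul_of_nonneg_left hrest (hφ x hx).le)

section CompactElements

variable {F : Type*} [NontriviallyNormedField F] [IsUltrametricDist F] {n : ℕ}
  {g : GL (Fin n) F}

theorem spectralNorm_le_spectralValue {x : AlgebraicClosure F} (hx : x ∈ eigenvalues g) :
    spectralNorm F (AlgebraicClosure F) x ≤ spectralValue g.val.charpoly :=
  norm_root_le_spectralValue (f := spectralAlgNorm F (AlgebraicClosure F))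
    spectralAlgNorm_isPowMul isNonarchimedean_spectralNorm (Matrix.charpoly_monic _)
    (Polynomial.mem_aroots.1 hx).2

theorem spectralValue_le {ρ : ℝ} (hρ : 0 ≤ ρ)
    (h : ∀ x ∈ eigenvalues g, spectralNorm F (AlgebraicClosure F) x ≤ ρ) :
    spectralValue g.val.charpoly ≤ ρ := by
  classical
  rw [← max_norm_root_eq_spectralValue (f := spectralAlgNorm F (AlgebraicClosure F))
    spectralAlgNorm_isPowMul isNonarchimedean_spectralNorm spectralAlgNorm_one
    g.val.charpoly (eigenvalues g)]
  · refine ciSup_le fun x => ?_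
    split_ifs with hx
    · exact h x hx
    · exact hρ
  · rw [Polynomial.mapAlg_eq_map]
    exact (IsAlgClosed.splits _).eq_prod_roots_of_monic ((Matrix.charpoly_monic _).map _)

theorem isClopen_setOf_norm_le {Y : Type*} [TopologicalSpace Y] {φ ψ : Y → F}
    (hφ : Continuous φ) (hψ : Continuous ψ) (hψ_ne : ∀ y, ψ y ≠ 0) :
    IsClopen {y | ‖φ y‖ ≤ ‖ψ y‖} := by
  have hpreimage : {y | ‖φ y‖ ≤ ‖ψ y‖} = (fun y => φ y / ψ y) ⁻¹' Metric.closedBall 0 1 := by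
    ext y
    simp [div_le_one₀ (norm_pos_iff.2 (hψ_ne y))]
  rw [hpreimage]
  exact (IsUltrametricDist.isClopen_closedBall 0 one_ne_zero).preimage (hφ.div₀ hψ hψ_ne)

variable [CompleteSpace F]

theorem prod_spectralNorm_eigenvalues (g : GL (Fin n) F) :
    ((eigenvalues g).map (spectralNorm F (AlgebraicClosure F))).prod = ‖g.val.det‖ := by
  have hmap :=
    (map_multiset_prod (spectralMulAlgNorm F (AlgebraicClosure F)) (eigenvalues g)).symm
  rw [prod_eigenvalues] at hmap
  exact hmap.trans (spectralNorm_extends _)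

theorem spectralNorm_eigenvalue_pos {x : AlgebraicClosure F} (hx : x ∈ eigenvalues g) :
    0 < spectralNorm F (AlgebraicClosure F) x := by
  refine (spectralNorm_nonneg _).lt_of_ne' fun hzero => det_ne_zero g (norm_eq_zero.1 ?_)
  rw [← prod_spectralNorm_eigenvalues]
  exact Multiset.prod_eq_zero (Multiset.mem_map.2 ⟨x, hx, hzero⟩)

theorem spectralNorm_eigenvalue_pow
    (hg : ∀ x ∈ eigenvalues g, ∀ y ∈ eigenvalues g,
      spectralNorm F (AlgebraicClosure F) x = spectralNorm F (AlgebraicClosure F) y)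
    {x : AlgebraicClosure F} (hx : x ∈ eigenvalues g) :
    spectralNorm F (AlgebraicClosure F) x ^ n = ‖g.val.det‖ := by
  have hmap : (eigenvalues g).map (spectralNorm F (AlgebraicClosure F)) =
      Multiset.replicate n (spectralNorm F (AlgebraicClosure F) x) := by
    rw [Multiset.eq_replicate, Multiset.card_map, card_eigenvalues]
    refine ⟨rfl, fun r hr => ?_⟩
    obtain ⟨y, hy, rfl⟩ := Multiset.mem_map.1 hr
    exact hg y hy x hx
  rw [← prod_spectralNorm_eigenvalues, hmap, Multiset.prod_replicate]

theorem spectralNorm_eigenvalues_eq_iff_spectralValue_le (hn : n ≠ 0) {ρ : ℝ} (hρ : 0 ≤ ρ)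
    (hdet : ρ ^ n = ‖g.val.det‖) :
    (∀ x ∈ eigenvalues g, ∀ y ∈ eigenvalues g,
      spectralNorm F (AlgebraicClosure F) x = spectralNorm F (AlgebraicClosure F) y) ↔
      spectralValue g.val.charpoly ≤ ρ := by
  refine ⟨fun h => spectralValue_le hρ fun x hx => ?_, fun hle => ?_⟩
  · refine ((pow_left_inj₀ (spectralNorm_nonneg _) hρ hn).1 ?_).le
    rw [spectralNorm_eigenvalue_pow h hx, hdet]
  · have heq (x : AlgebraicClosure F) (hx : x ∈ eigenvalues g) :
        spectralNorm F (AlgebraicClosure F) x = ρ :=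
      eq_of_prod_map_eq_pow (fun _ => spectralNorm_eigenvalue_pos)
        (fun _ hx => (spectralNorm_le_spectralValue hx).trans hle)
        (by rw [prod_spectralNorm_eigenvalues, card_eigenvalues, hdet]) hx
    exact fun x hx y hy => (heq x hx).trans (heq y hy).symm

theorem spectralNorm_eigenvalues_eq_iff_norm_coeff_le (hn : n ≠ 0) (g : GL (Fin n) F) :
    (∀ x ∈ eigenvalues g, ∀ y ∈ eigenvalues g,
      spectralNorm F (AlgebraicClosure F) x = spectralNorm F (AlgebraicClosure F) y) ↔
      ∀ k < n, ‖g.val.charpoly.coeff k‖ ^ n ≤ ‖g.val.det‖ ^ (n - k) := by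
  obtain ⟨ρ, hρ, hdet⟩ : ∃ ρ : ℝ, 0 ≤ ρ ∧ ρ ^ n = ‖g.val.det‖ :=
    ⟨_, Real.rpow_nonneg (norm_nonneg _) _, Real.rpow_inv_natCast_pow (norm_nonneg _) hn⟩
  rw [spectralNorm_eigenvalues_eq_iff_spectralValue_le hn hρ hdet, spectralValue_le_iff hρ,
    Matrix.charpoly_natDegree_eq_dim, Fintype.card_fin]
  refine forall₂_congr fun k _ => ?_
  rw [← hdet, pow_right_comm, pow_le_pow_iff_left₀ (norm_nonneg _) (pow_nonneg hρ _) hn]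

theorem isClopen_compactElements (c : Composition n) : IsClopen (compactElements F c) := by
  have hinter : compactElements F c = ⋂ i, ⋂ k : Fin (c.blocksFun i),
      {m : Levi F c | ‖(m i).val.charpoly.coeff k ^ c.blocksFun i‖ ≤
        ‖(m i).val.det ^ (c.blocksFun i - k)‖} := by
    ext m
    simp only [compactElements, Set.mem_ofPred_eq, Set.mem_iInter, norm_pow]
    refine forall_congr' fun i => ?_
    rw [Fin.forall_iff, spectralNorm_eigenvalues_eq_iff_norm_coeff_le
      (Nat.one_le_iff_ne_zero.1 (c.one_le_blocksFun i))]
  rw [hinter]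
  refine isClopen_iInter_of_finite fun i => isClopen_iInter_of_finite fun k =>
    isClopen_setOf_norm_le ?_ ?_ fun m => pow_ne_zero _ (det_ne_zero (m i))
  · exact ((continuous_charpoly_coeff _).comp (continuous_apply i)).pow _
  · exact ((Units.continuous_val.comp (continuous_apply i)).matrix_det).pow _

theorem isLocallyConstant_charCompact (c : Composition n) :
    IsLocallyConstant (charCompact (F := F) c) := by
  classical
  refine (IsLocallyConstant.iff_eventually_eq _).2 fun m => ?_
  by_cases hm : m ∈ compactElements F c
  · filter_upwards [(isClopen_compactElements c).isOpen.mem_nhds hm] with m' hm'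
    simp only [charCompact, Set.indicator_of_mem, hm, hm', Pi.one_apply]
  · filter_upwards [(isClopen_compactElements c).compl.isOpen.mem_nhds hm] with m' hm'
    rw [charCompact, Set.indicator_of_notMem hm, Set.indicator_of_notMem hm']

theorem IsHecke.charCompact_mul {c : Composition n} {φ : Levi F c → ℂ} (hφ : IsHecke φ) :
    IsHecke fun m => charCompact c m * φ m where
  locConst := (isLocallyConstant_charCompact c).mul hφ.locConst
  compactSupport := hφ.compactSupport.mul_left

end CompactElements

/-! ### Slopes and truncations -/

section CompositionIndex

variable {n : ℕ}

theorem index_monotone (c : Composition n) : Monotone c.index := fun a b hab => by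
  by_contra! hlt
  exact (lt_of_index_lt c hlt).not_ge hab

theorem castSucc_mem_boundaries_iff (c : Composition n) (b : Fin n) :
    b.castSucc ∈ c.boundaries ↔ ∀ a < b, c.index a < c.index b := by
  have hmem : b.castSucc ∈ c.boundaries ↔ ∃ i : Fin (c.length + 1), c.sizeUpTo i = b := by
    simp [Composition.boundaries, Composition.boundary, Fin.ext_iff]
  rw [hmem]
  constructor
  · rintro ⟨i, hi⟩ a hab
    have hlt : (c.index a : ℕ) < i := by
      by_contra! hle
      exact hab.not_ge (hi.symm.le.trans ((c.monotone_sizeUpTo hle).trans (c.sizeUpTo_index_le a)))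
    have hle : (i : ℕ) ≤ c.index b := by
      by_contra! hlt
      exact ((c.lt_sizeUpTo_index_succ b).trans_le (c.monotone_sizeUpTo hlt)).ne' hi
    exact hlt.trans_le hle
  · refine fun h => ⟨(c.index b).castSucc, (c.sizeUpTo_index_le b).antisymm ?_⟩
    by_contra! hlt
    let a : Fin n := ⟨c.sizeUpTo (c.index b), hlt.trans b.isLt⟩
    exact ((c.lt_sizeUpTo_index_succ a).trans_le (c.monotone_sizeUpTo (h a hlt))).false

theorem eq_of_index_lt_iff {c d : Composition n}
    (h : ∀ a b, d.index a < d.index b ↔ c.index a < c.index b) : d = c := by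
  refine (compositionEquiv n).injective (CompositionAsSet.ext ?_)
  change d.boundaries = c.boundaries
  ext j
  induction j using Fin.lastCases with
  | last => exact iff_of_true d.toCompositionAsSet.getLast_mem c.toCompositionAsSet.getLast_mem
  | cast j => simp_rw [castSucc_mem_boundaries_iff, h]

end CompositionIndex

section BlockSlope

variable {F : Type*} [NontriviallyNormedField F] [IsUltrametricDist F] {n : ℕ}

/-- The slope `v(det m_i) / n_i` of the `i`-th block of an element of the Levi subgroup: the common
valuation of the eigenvalues of `m_i` when `m` is compact. -/
noncomputable def blockSlope (c : Composition n) (m : Levi F c) (i : Fin c.length) : ℝ :=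
  val (m i).val.det / c.blocksFun i

theorem mem_positiveChamber_iff (c : Composition n) (m : Levi F c) :
    m ∈ positiveChamber F c ↔ StrictAnti (blockSlope c m) :=
  ⟨fun h _ _ => h _ _, fun h _ _ hij => h hij⟩

theorem blocksFun_cast_ne_zero (c : Composition n) (i : Fin c.length) :
    (c.blocksFun i : ℝ) ≠ 0 :=
  Nat.cast_ne_zero.2 (Nat.one_le_iff_ne_zero.1 (c.one_le_blocksFun i))

theorem sum_blockSlope_mul (c : Composition n) (m : Levi F c) :
    ∑ i, blockSlope c m i * c.blocksFun i = val (∏ i, (m i).val.det) := by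
  simp_rw [blockSlope, div_mul_cancel₀ _ (blocksFun_cast_ne_zero c _), val, norm_prod]
  rw [Finset.sum_neg_distrib,
    Real.logb_prod _ _ fun i _ => norm_ne_zero_iff.2 (det_ne_zero (m i))]

theorem val_eq_natCast_iff {ϖ : F} (hϖ : IsNormalizedUniformizer ϖ) {x : F} (hx : x ≠ 0)
    (k : ℕ) : val x = k ↔ ‖x‖ = ‖ϖ‖ ^ k := by
  have hq : (1 : ℝ) < resCard F := by exact_mod_cast hϖ.one_lt_resCard
  have hq_pos : (0 : ℝ) < resCard F := zero_lt_one.trans hq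
  rw [val, neg_eq_iff_eq_neg, Real.logb_eq_iff_rpow_eq hq_pos hq.ne' (norm_pos_iff.2 hx),
    Real.rpow_neg hq_pos.le, Real.rpow_natCast, hϖ.norm_eq, inv_pow, eq_comm]

theorem blockSlope_eq_div_iff {ϖ : F} (hϖ : IsNormalizedUniformizer ϖ) (c : Composition n)
    (m : Levi F c) (i : Fin c.length) (k : ℕ) :
    blockSlope c m i = k / c.blocksFun i ↔ detNorms F c m i = ‖ϖ‖ ^ k := by
  rw [blockSlope, div_left_inj' (blocksFun_cast_ne_zero c i),
    val_eq_natCast_iff hϖ (det_ne_zero (m i)), detNorms_apply]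

variable [CompleteSpace F]

theorem map_valBar_eigenvalues (c : Composition n) {m : Levi F c} (hm : m ∈ compactElements F c)
    (i : Fin c.length) :
    (eigenvalues (m i)).map valBar = Multiset.replicate (c.blocksFun i) (blockSlope c m i) := by
  rw [Multiset.eq_replicate, Multiset.card_map, card_eigenvalues]
  refine ⟨rfl, fun r hr => ?_⟩
  obtain ⟨x, hx, rfl⟩ := Multiset.mem_map.1 hr
  rw [blockSlope, val, valBar, ← spectralNorm_eigenvalue_pow (hm i) hx, Real.logb_pow,
    eq_div_iff (blocksFun_cast_ne_zero c i)]
  ring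

theorem slopes_leviEmb (c : Composition n) {m : Levi F c} (hm : m ∈ compactElements F c)
    (hpos : m ∈ positiveChamber F c) :
    slopes (leviEmb c m) = List.ofFn fun a => blockSlope c m (c.index a) := by
  have hlist : (List.ofFn fun a => blockSlope c m (c.index a) : Multiset ℝ) =
      ∑ a, {blockSlope c m (c.index a)} := by
    rw [← Fin.univ_val_map, ← Multiset.sum_map_singleton (Multiset.map _ _), Multiset.map_map]
    rfl
  have hmap : (eigenvalues (leviEmb c m)).map valBar =
      (List.ofFn fun a => blockSlope c m (c.index a) : Multiset ℝ) := by
    rw [hlist, ← c.blocksFinEquiv.sum_comp, Fintype.sum_sigma, eigenvalues_leviEmb,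
      ← Multiset.coe_mapAddMonoidHom, map_sum]
    refine Finset.sum_congr rfl fun i _ => ?_
    have hindex (p : Fin (c.blocksFun i)) : c.index (c.blocksFinEquiv ⟨i, p⟩) = i :=
      c.index_embedding i p
    simp [map_valBar_eigenvalues c hm, hindex, Multiset.nsmul_singleton]
  rw [slopes, hmap, Multiset.coe_sort]
  exact List.mergeSort_eq_self _ (List.pairwise_ofFn.2 fun a b hab =>
    ((mem_positiveChamber_iff c m).1 hpos).antitone (index_monotone c hab.le))

end BlockSlope

section Truncation

variable {F : Type*} [NontriviallyNormedField F] [IsUltrametricDist F] [ProperSpace F]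
  [MeasurableSpace F] [BorelSpace F] {n : ℕ} {f : GL (Fin n) F → ℂ}
  {c : Composition n} {lam : Fin c.length → ℝ}

theorem exists_blockSlope_eq_of_truncation_ne_zero {d : Composition n} {m : Levi F d}
    (hm : truncation d (repeatVec c lam) f m ≠ 0) :
    StrictAnti (blockSlope d m) ∧ constantTerm d f m ≠ 0 ∧
      ∃ t : ℝ, 0 < t ∧ ∀ a, blockSlope d m (d.index a) = t * lam (c.index a) := by
  rw [truncation, mul_ne_zero_iff, mul_ne_zero_iff, mul_ne_zero_iff] at hm
  obtain ⟨⟨⟨hcompact, hslope⟩, hpos⟩, hterm⟩ := hm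
  replace hcompact : m ∈ compactElements F d := Set.mem_of_indicator_ne_zero hcompact
  replace hpos : m ∈ positiveChamber F d := Set.mem_of_indicator_ne_zero hpos
  obtain ⟨t, ht, hslope⟩ : leviEmb d m ∈ slopeSet F (repeatVec c lam) :=
    Set.mem_of_indicator_ne_zero hslope
  rw [slopes_leviEmb d hcompact hpos] at hslope
  exact ⟨(mem_positiveChamber_iff d m).1 hpos, hterm, t, ht,
    congrFun (List.ofFn_injective hslope)⟩

theorem truncation_eq_zero_of_ne (hlam : StrictAnti lam) {d : Composition n} (hdc : d ≠ c) :
    truncation d (repeatVec c lam) f = fun _ => 0 := by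
  funext m
  by_contra hm
  obtain ⟨hanti, -, t, ht, heq⟩ := exists_blockSlope_eq_of_truncation_ne_zero hm
  refine hdc (eq_of_index_lt_iff fun a b => ?_)
  rw [← hanti.lt_iff_gt, heq, heq, mul_lt_mul_iff_right₀ ht, hlam.lt_iff_gt]

theorem truncation_eq_constantTerm (hlam : StrictAnti lam) {t : ℝ} (ht : 0 < t) {m : Levi F c}
    (hm : m ∈ compactElements F c) (hslope : ∀ i, blockSlope c m i = t * lam i) :
    truncation c (repeatVec c lam) f m = constantTerm c f m := by
  have hpos : m ∈ positiveChamber F c := by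
    rw [mem_positiveChamber_iff, funext hslope]
    exact hlam.const_mul ht
  have hmem : leviEmb c m ∈ slopeSet F (repeatVec c lam) :=
    ⟨t, ht, by simp_rw [slopes_leviEmb c hm hpos, hslope, repeatVec]⟩
  simp only [truncation, charCompact, charSlope, charPositive, Set.indicator_of_mem, hm, hmem,
    hpos, Pi.one_apply, one_mul]

variable {ϖ : F} {α s : ℕ} {si : Fin c.length → ℕ}

theorem IsKottwitzFunction.blockSlope_eq_of_truncation_ne_zero
    (hf : IsKottwitzFunction ϖ n α s f) (hϖ : IsNormalizedUniformizer ϖ) (hα : 0 < α)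
    (hlam_int : ∀ i, lam i * c.blocksFun i = si i) (hsi : ∑ i, si i = s) {m : Levi F c}
    (hm : truncation c (repeatVec c lam) f m ≠ 0) (i : Fin c.length) :
    blockSlope c m i = α * lam i := by
  obtain ⟨-, hterm, t, -, ht⟩ := exists_blockSlope_eq_of_truncation_ne_zero hm
  replace ht (i) : blockSlope c m i = t * lam i := by
    simpa using ht (c.embedding i ⟨0, c.one_le_blocksFun i⟩)
  have hdet := hf.prod_norm_det_of_constantTerm_ne_zero hϖ hα c hterm
  rw [← norm_prod, ← val_eq_natCast_iff hϖ (Finset.prod_ne_zero_iff.2 fun i _ => det_ne_zero _),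
    ← sum_blockSlope_mul] at hdet
  simp_rw [ht, mul_assoc, hlam_int, ← Finset.mul_sum, ← Nat.cast_sum, hsi, Nat.cast_mul] at hdet
  rcases mul_eq_mul_right_iff.1 hdet with htα | hs
  · rw [ht, htα]
  · have hsi_zero : si i = 0 :=
      Finset.sum_eq_zero_iff.1 (hsi.trans (Nat.cast_eq_zero.1 hs)) i (Finset.mem_univ i)
    have hlam_zero : lam i = 0 := by
      simpa [hsi_zero, blocksFun_cast_ne_zero c i] using hlam_int i
    rw [ht, hlam_zero, mul_zero, mul_zero]

theorem IsKottwitzFunction.truncation_eq_charCompact_mul_indicator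
    (hf : IsKottwitzFunction ϖ n α s f) (hϖ : IsNormalizedUniformizer ϖ) (hα : 0 < α)
    (hlam : StrictAnti lam) (hlam_int : ∀ i, lam i * c.blocksFun i = si i)
    (hsi : ∑ i, si i = s) (m : Levi F c) :
    truncation c (repeatVec c lam) f m = charCompact c m *
      (detNorms F c ⁻¹' {fun i => ‖ϖ‖ ^ (α * si i)}).indicator (constantTerm c f) m := by
  have hslope_iff (i : Fin c.length) :
      blockSlope c m i = α * lam i ↔ detNorms F c m i = ‖ϖ‖ ^ (α * si i) := by
    rw [← blockSlope_eq_div_iff hϖ, Nat.cast_mul, ← hlam_int, ← mul_assoc,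
      mul_div_cancel_right₀ _ (blocksFun_cast_ne_zero c i)]
  by_cases hm : m ∈ compactElements F c
  swap
  · rw [truncation, charCompact, Set.indicator_of_notMem hm, zero_mul, zero_mul, zero_mul, zero_mul]
  rw [charCompact, Set.indicator_of_mem hm, Pi.one_apply, one_mul]
  by_cases hdet : m ∈ detNorms F c ⁻¹' {fun i => ‖ϖ‖ ^ (α * si i)}
  · rw [Set.indicator_of_mem hdet]
    exact truncation_eq_constantTerm hlam (Nat.cast_pos.2 hα) hm fun i =>
      (hslope_iff i).2 (congrFun hdet i)
  · rw [Set.indicator_of_notMem hdet]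
    by_contra hne
    exact hdet (funext fun i => (hslope_iff i).1
      (hf.blockSlope_eq_of_truncation_ne_zero hϖ hα hlam_int hsi hne i))

end Truncation

end GLTrunc


theorem proposition3p3_general {F : Type*} [NontriviallyNormedField F] [IsUltrametricDist F]
    [ProperSpace F] [MeasurableSpace F] [BorelSpace F]
    (ϖ : F) (hϖ : GLTrunc.IsNormalizedUniformizer ϖ) (n α s : ℕ) (hα : 0 < α)
    (c : Composition n) (lam : Fin c.length → ℝ) (si : Fin c.length → ℕ)
    (hlam_int : ∀ i, lam i * (c.blocksFun i : ℝ) = (si i : ℝ))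
    (hlam_sum : ∑ i, lam i * (c.blocksFun i : ℝ) = (s : ℝ))
    (hlam_anti : ∀ i j, i < j → lam j < lam i)
    (f : GL (Fin n) F → ℂ) (hf : GLTrunc.IsKottwitzFunction ϖ n α s f)
    (fi : ∀ i : Fin c.length, GL (Fin (c.blocksFun i)) F → ℂ)
    (hfi : ∀ i, GLTrunc.IsKottwitzFunction ϖ (c.blocksFun i) α (si i) (fi i)) :
    (∀ d : Composition n, d ≠ c →
      GLTrunc.truncation d (GLTrunc.repeatVec c lam) f = fun _ => 0) ∧
    GLTrunc.IsHecke (GLTrunc.truncation c (GLTrunc.repeatVec c lam) f) ∧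
    GLTrunc.truncation c (GLTrunc.repeatVec c lam) f = fun m =>
      (((GLTrunc.resCard F : ℝ) ^ ((α : ℝ) * GLTrunc.constC c s si) : ℝ) : ℂ) *
        (GLTrunc.charCompact c m * ∏ i, fi i (m i)) := by
  have hlam : StrictAnti lam := fun i j => hlam_anti i j
  have hsi : ∑ i, si i = s := by
    simp_rw [hlam_int] at hlam_sum
    exact_mod_cast hlam_sum
  have htrunc := funext fun m =>
    hf.truncation_eq_charCompact_mul_indicator hϖ hα hlam hlam_int hsi m
  rw [hf.indicator_constantTerm_eq hϖ hα c hsi hfi] at htrunc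
  refine ⟨fun d => GLTrunc.truncation_eq_zero_of_ne hlam, ?_, htrunc.trans ?_⟩
  · rw [htrunc]
    exact ((GLTrunc.IsUnramifiedLevi.prod fun i =>
      (hfi i).unramified).const_mul _).toIsHecke.charCompact_mul
  · exact funext fun m => mul_left_comm _ _ _

theorem proposition3p3 {F : Type*} [NontriviallyNormedField F] [IsUltrametricDist F]
    [ProperSpace F] [CharZero F] [MeasurableSpace F] [BorelSpace F]
    (ϖ : F) (hϖ : GLTrunc.IsNormalizedUniformizer ϖ)
    (n α s : ℕ) (hα : 0 < α) (hs : 0 < s) (hsn : s ≤ n)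
    (c : Composition n) (lam : Fin c.length → ℝ) (si : Fin c.length → ℕ)
    (hlam_int : ∀ i, lam i * (c.blocksFun i : ℝ) = (si i : ℝ))
    (hlam_sum : ∑ i, lam i * (c.blocksFun i : ℝ) = (s : ℝ))
    (hlam_anti : ∀ i j, i < j → lam j < lam i)
    (f : GL (Fin n) F → ℂ) (hf : GLTrunc.IsKottwitzFunction ϖ n α s f)
    (fi : ∀ i : Fin c.length, GL (Fin (c.blocksFun i)) F → ℂ)
    (hfi : ∀ i, GLTrunc.IsKottwitzFunction ϖ (c.blocksFun i) α (si i) (fi i)) :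
    (∀ d : Composition n, d ≠ c →
      GLTrunc.truncation d (GLTrunc.repeatVec c lam) f = fun _ => 0) ∧
    GLTrunc.IsHecke (GLTrunc.truncation c (GLTrunc.repeatVec c lam) f) ∧
    GLTrunc.truncation c (GLTrunc.repeatVec c lam) f = fun m =>
      (((GLTrunc.resCard F : ℝ) ^ ((α : ℝ) * GLTrunc.constC c s si) : ℝ) : ℂ) *
        (GLTrunc.charCompact c m * ∏ i, fi i (m i)) :=
  proposition3p3_general ϖ hϖ n α s hα c lam si hlam_int hlam_sum hlam_anti f hf fi hfi
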